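/- \textbf{Setting.} A $*$-permutation of length $n$ is a map $\sigma:\{1,2,3,\dots\}\to\{1,\dots,n\}\cup\{*\}$ such that each element of $\{1,\dots,n\}$ (a concrete symbol) has exactly one preimage. A linearized forest with $n$ carets is a sequence $t_0,t_1,t_2,\dots$ of finite binary rooted trees with $n$ interior vertices in total, which are labelled bijectively by $1,\dots,n$ so that labels decrease along every path from a root to a leaf. The leaves of the whole forest are numbered $0,1,2,\dots$ from left to right. The interior vertex covering the gap $(p-1,p)$ is the last common vertex of the paths from the root to the leaves $p-1$ and $p$, if these leaves lie in the same tree; otherwise the gap is not covered. Linearized forests with $n$ carets correspond bijectively to $*$-permutations of length $n$: the forest corresponds to the $\sigma$ for which $\sigma(p)$ is the label of the interior vertex covering the gap $(p-1,p)$, and $\sigma(p)=*$ if this gap is not covered. In the same way, linearized binary trees with $m$ interior vertices correspond to permutations in $S_m$. Two $*$-permutations (respectively, two permutations in $S_m$) are related by $\sim$ if the corresponding linearized forests (respectively, trees) become equal when the labels on all interior vertices are deleted. The weak Bruhat order on $S_n$ is the reflexive transitive closure of the relation in which $\sigma$ is covered by $\rho$ if $\rho=(i\ \,i{+}1)\circ\sigma$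 for some $1\le i<n$ and the length of $\rho$ with respect to the generators $(1\,2),\dots,(n{-}1\ \,n)$ is larger than the length of $\sigma$. Fix $k$ blocks of consecutive positions in $\{1,2,3,\dots\}$, of sizes $m_1,\dots,m_k\ge 1$ from left to right, any two of them separated by at least one position, and let $n=m_1+\dots+m_k$. Let $S_n'$ be the set of the $n!$ $*$-permutations of length $n$ whose concrete symbols occupy exactly the positions in these blocks. It is ordered by the weak Bruhat order induced from $S_n$ through the bijection $S_n'\to S_n$ that removes all $*$'s. \textbf{Theorem.} The weak Bruhat orders on $S_n'$ and on $S_{m_1},\dots,S_{m_k}$ are lattice orders, the relation $\sim$ is a lattice congruence on $S_n'$ and on each $S_{m_i}$, and \[ S_n'/{\sim}\;\cong\; S_{m_1}/{\sim}\times\dots\times S_{m_k}/{\sim} \] as lattices. -/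

import Mathlib

/-! ### Linearized labelled binary trees and forests -/

namespace Tamari

/-- The labels of the interior vertices of a binary tree. -/
def labels {α : Type*} : BinaryTree α → List α
  | .nil => []
  | .node a l r => labels l ++ a :: labels r

/-- The labels of the interior vertices decrease along every path from the root to a leaf. -/
def IsDecreasing {α : Type*} [LT α] : BinaryTree α → Prop
  | .nil => True
  | .node a l r =>
      (∀ b ∈ labels l, b < a) ∧ (∀ b ∈ labels r, b < a) ∧ IsDecreasing l ∧ IsDecreasing r

/-- Number the leaves of a tree with `N` interior vertices `0, 1, …, N` from left to right.
`caretLabel t i` is the label of the interior vertex which is the last common vertex of the paths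
from the root to the leaves `i` and `i + 1`, i.e. of the caret that covers the gap `(i, i + 1)`.
It is `⊤` (standing for `*`) when there is no such gap in `t`, i.e. when `N ≤ i`. -/
def caretLabel {α : Type*} : BinaryTree α → ℕ → WithTop α
  | .nil, _ => ⊤
  | .node a l r, i =>
      if i < l.numNodes then caretLabel l i
      else if i = l.numNodes then (a : WithTop α)
      else caretLabel r (i - (l.numNodes + 1))

/-- A forest is an infinite sequence of trees (the index of a tree is the label of its root); its
leaves are numbered `0, 1, 2, …` from left to right throughout the whole forest.
`gapLabel f i` is the label of the caret covering the gap `(i, i + 1)`, or `⊤` (standing for `*`)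
if the leaves `i` and `i + 1` lie in different trees. -/
def gapLabel {α : Type*} (f : ℕ → BinaryTree α) (i : ℕ) : WithTop α :=
  if i ≤ (f 0).numNodes then caretLabel (f 0) i
  else gapLabel (fun r => f (r + 1)) (i - ((f 0).numNodes + 1))
termination_by i

/-- The tree obtained by deleting all labels on the interior vertices. -/
def shape {α : Type*} (t : BinaryTree α) : BinaryTree Unit :=
  t.map fun _ => ()

/-- Linearized labelled binary rooted trees with `n` interior vertices. The labels `1, …, n` of the
interior vertices are represented by the elements of `Fin n`. -/
structure LinTree (n : ℕ) where
  tree : BinaryTree (Fin n)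
  decreasing : IsDecreasing tree
  nodup : (labels tree).Nodup
  exhaust : ∀ j : Fin n, j ∈ labels tree

/-- Linearized labelled binary rooted forests with `n` carets: every label is the label of exactly
one caret of the forest. (Hence only finitely many of the trees are non-trivial.) -/
structure LinForest (n : ℕ) where
  tree : ℕ → BinaryTree (Fin n)
  decreasing : ∀ r, IsDecreasing (tree r)
  nodup : ∀ r, (labels (tree r)).Nodup
  existsUnique : ∀ j : Fin n, ∃! r, j ∈ labels (tree r)

/-- `∗`-permutations of length `n`: maps `σ : {1, 2, …} → {1, …, n} ∪ {*}` such that every element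
of `{1, …, n}` has exactly one preimage. The symbol `*` is `⊤`, and `1, …, n` are the elements of
`Fin n`. -/
def StarPerm (n : ℕ) : Type :=
  {σ : ℕ+ → WithTop (Fin n) // ∀ j : Fin n, ∃! p, σ p = (j : WithTop (Fin n))}

/-- The linearized tree `t` corresponds to the permutation `σ`: the value of `σ` at the `i`-th
position is the label of the caret covering the `i`-th gap of `t`. -/
def LinTree.Represents {n : ℕ} (t : LinTree n) (σ : Equiv.Perm (Fin n)) : Prop :=
  ∀ i : Fin n, caretLabel t.tree i = (σ i : WithTop (Fin n))

/-- The linearized forest `f` corresponds to the `∗`-permutation `σ`: the value of `σ` at `p` is the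
label of the caret covering the gap `(p - 1, p)` of `f`, and `*` if this gap is not covered. -/
def LinForest.Represents {n : ℕ} (f : LinForest n) (σ : StarPerm n) : Prop :=
  ∀ p : ℕ+, gapLabel f.tree p.natPred = σ.1 p

/-- The relation `∼` on `S_n`: the linearized trees that correspond to the two permutations become
equal when the labels on the interior vertices are deleted. -/
def PermEquiv {n : ℕ} (σ ρ : Equiv.Perm (Fin n)) : Prop :=
  ∃ s t : LinTree n, s.Represents σ ∧ t.Represents ρ ∧ shape s.tree = shape t.tree

/-- The relation `∼` on `∗`-permutations: the linearized forests that correspond to the two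
`∗`-permutations become equal when the labels on the interior vertices are deleted. -/
def StarEquiv {n : ℕ} (σ ρ : StarPerm n) : Prop :=
  ∃ f g : LinForest n, f.Represents σ ∧ g.Represents ρ ∧
    ∀ r, shape (f.tree r) = shape (g.tree r)

/-! ### The weak Bruhat order -/

/-- The standard generators `(i i+1)` of the symmetric group. -/
def IsStandardReflection {n : ℕ} (s : Equiv.Perm (Fin n)) : Prop :=
  ∃ i j : Fin n, (j : ℕ) = (i : ℕ) + 1 ∧ s = Equiv.swap i j

/-- The length of a permutation with respect to the standard generators. -/
noncomputable def length {n : ℕ} (σ : Equiv.Perm (Fin n)) : ℕ :=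
  sInf {l : ℕ | ∃ w : List (Equiv.Perm (Fin n)),
    (∀ s ∈ w, IsStandardReflection s) ∧ w.prod = σ ∧ w.length = l}

/-- `σ` is covered by `ρ` in the (left) weak Bruhat order. -/
def WeakCover {n : ℕ} (σ ρ : Equiv.Perm (Fin n)) : Prop :=
  (∃ s, IsStandardReflection s ∧ ρ = s * σ) ∧ length σ < length ρ

/-- The (left) weak Bruhat order on `S_n`. -/
def WeakLE {n : ℕ} : Equiv.Perm (Fin n) → Equiv.Perm (Fin n) → Prop :=
  Relation.ReflTransGen WeakCover

/-! ### `∗`-permutations with a fixed block pattern -/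

/-- A pattern of `k` blocks of consecutive positions. The `i`-th block consists of the positions
`start i, …, start i + size i - 1`; the blocks are listed from left to right, and any two of them
are separated by at least one position. -/
structure BlockPattern (k : ℕ) where
  start : Fin k → ℕ+
  size : Fin k → ℕ+
  separated : ∀ i j : Fin k, i < j → start i + size i < start j

/-- The positions of the concrete symbols. -/
def BlockPattern.positions {k : ℕ} (P : BlockPattern k) : Finset ℕ+ :=
  Finset.univ.biUnion fun i => Finset.Ico (P.start i) (P.start i + P.size i)

/-- The number `n` of concrete symbols. -/
def BlockPattern.n {k : ℕ} (P : BlockPattern k) : ℕ :=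
  P.positions.card

/-- The set `S_n'` of the `∗`-permutations whose concrete symbols occupy exactly the positions of
the given block pattern. -/
def PatternPerm {k : ℕ} (P : BlockPattern k) : Type :=
  {σ : StarPerm P.n // ∀ p, σ.1 p ≠ ⊤ ↔ p ∈ P.positions}

/-- The `i`-th concrete symbol, from left to right, of a `∗`-permutation in `S_n'`. -/
def PatternPerm.symbol {k : ℕ} {P : BlockPattern k} (σ : PatternPerm P) (i : Fin P.n) : Fin P.n :=
  (σ.1.1 (P.positions.orderEmbOfFin rfl i)).untop
    ((σ.2 _).2 (P.positions.orderEmbOfFin_mem rfl i))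

theorem PatternPerm.symbol_injective {k : ℕ} {P : BlockPattern k} (σ : PatternPerm P) :
    Function.Injective σ.symbol := by
  intro i j h
  have hi : σ.1.1 (P.positions.orderEmbOfFin rfl i) = (σ.symbol i : WithTop (Fin P.n)) :=
    (WithTop.coe_untop _ _).symm
  have hj : σ.1.1 (P.positions.orderEmbOfFin rfl j) = (σ.symbol i : WithTop (Fin P.n)) := by
    rw [h]
    exact (WithTop.coe_untop _ _).symm
  exact (P.positions.orderEmbOfFin rfl).injective ((σ.1.2 (σ.symbol i)).unique hi hj)

/-- The permutation in `S_n` obtained from a `∗`-permutation in `S_n'` by removing all `*`. -/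
noncomputable def PatternPerm.removeStars {k : ℕ} {P : BlockPattern k} (σ : PatternPerm P) :
    Equiv.Perm (Fin P.n) :=
  Equiv.ofBijective σ.symbol (Finite.injective_iff_bijective.mp σ.symbol_injective)

/-- The weak Bruhat order on `S_n'`, induced from `S_n` by removing all `*`. -/
def PatternPerm.WeakLE {k : ℕ} {P : BlockPattern k} (σ ρ : PatternPerm P) : Prop :=
  Tamari.WeakLE σ.removeStars ρ.removeStars

/-! ### The quotient of a lattice by a lattice congruence -/

/-- The set of classes of a lattice congruence. -/
def LatticeQuotient {α : Type*} [Lattice α] (c : LatticeCon α) : Type _ :=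
  Quotient c.toSetoid

/-- The quotient lattice: joins and meets are computed on representatives. -/
instance {α : Type*} [Lattice α] (c : LatticeCon α) : Lattice (LatticeQuotient c) :=
  letI : Max (LatticeQuotient c) :=
    ⟨Quotient.map₂ (· ⊔ ·) fun _ _ h _ _ h' => c.sup h h'⟩
  letI : Min (LatticeQuotient c) :=
    ⟨Quotient.map₂ (· ⊓ ·) fun _ _ h _ _ h' => c.inf h h'⟩
  Lattice.mk'
    (by rintro ⟨a⟩ ⟨b⟩; exact congrArg (Quotient.mk c.toSetoid) (sup_comm a b))
    (by rintro ⟨a⟩ ⟨b⟩ ⟨d⟩; exact congrArg (Quotient.mk c.toSetoid) (sup_assoc a b d))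
    (by rintro ⟨a⟩ ⟨b⟩; exact congrArg (Quotient.mk c.toSetoid) (inf_comm a b))
    (by rintro ⟨a⟩ ⟨b⟩ ⟨d⟩; exact congrArg (Quotient.mk c.toSetoid) (inf_assoc a b d))
    (by rintro ⟨a⟩ ⟨b⟩; exact congrArg (Quotient.mk c.toSetoid) sup_inf_self)
    (by rintro ⟨a⟩ ⟨b⟩; exact congrArg (Quotient.mk c.toSetoid) inf_sup_self)

end Tamari

/-!
The whole argument takes place in terms of inversions, i.e. pairs of positions `a < b` with
`σ b < σ a`.

An ascending exchange of the adjacent values `i` and `i + 1` adds exactly one inversion, so the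
length is the number of inversions and the weak Bruhat order is inclusion of the sets of inversions
(`weakLE_iff`). A relation is the inversion relation of a permutation as soon as it is contained in
`<`, transitive and, for `a < b < c`, relates `a` to `b` or `b` to `c` whenever it relates `a` to `c`
(`exists_inverted_iff`). The transitive closure of the union of two inversion relations is of this
kind, which gives joins; the same construction for non-inversions gives meets (`weakLattice`).

The shape of the decreasing forest of `σ` is determined by, and determines, the pairs `a ≤ b` for
which `σ b` is larger than all of `σ a, …, σ (b - 1)`, since these are the pairs for which the caret
at `a` is the caret at `b` or lies in its left subtree (`shape_eq_iff`, `forall_shape_eq_iff`). Call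
them left spans. No value in a left span `(a, b)` forms an inversion with `b`, and a chain of
inversions that ends at `b` has a last step; so the left spans of `σ ⊔ ρ` are the common left spans
of `σ` and `ρ` (`leftSpan_weakSup`), and `∼` is compatible with joins. Symmetrically, the right spans
of `σ ⊓ ρ` are the common right spans (`rightSpan_weakInf`). As left spans and right spans determine
each other (`leftSpan_congr_iff_rightSpan_congr`), `∼` is compatible with meets as well.

It also follows that the order of the quotient lattice is the reverse inclusion of left spans
(`spanCon_mk_le_mk_iff`). For a `∗`-permutation, a left span does not extend over a `∗` and hence
lies in one block, and its existence depends only on the pattern of the values in that block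
(`PatternPerm.leftSpan_imp_iff_blockPerm`). Since every family of patterns occurs
(`PatternPerm.exists_blockPerm_eq`), the quotient of `S_n'` is the product of the quotients of the
`S_{m_i}`.
-/

namespace Tamari

/-! ### Left domination and the shape of decreasing trees -/

section Trees

variable {α : Type*} [LinearOrder α]

/-- The entry of `φ` at `y` is not `*` and is larger than all entries of `φ` at `x, …, y - 1`. If
`φ` lists the labels of a decreasing forest from left to right, this says that the caret at the
gap `x` is the caret at the gap `y` or lies in its left subtree. -/
def LeftDominates (φ : ℕ → WithTop α) (x y : ℕ) : Prop :=
  x ≤ y ∧ φ y ≠ ⊤ ∧ ∀ z, x ≤ z → z < y → φ z < φ y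

/-- In an unlabelled tree, the `x`-th interior vertex from the left is the `y`-th one or lies in its
left subtree. -/
def IsLeftDescendant : BinaryTree Unit → ℕ → ℕ → Prop
  | .nil, _, _ => False
  | .node _ l r, x, y =>
      (y < l.numNodes ∧ IsLeftDescendant l x y) ∨ (x ≤ y ∧ y = l.numNodes) ∨
        (l.numNodes < x ∧ x ≤ y ∧
          IsLeftDescendant r (x - (l.numNodes + 1)) (y - (l.numNodes + 1)))

theorem IsLeftDescendant.le {t : BinaryTree Unit} {x y : ℕ} (h : IsLeftDescendant t x y) :
    x ≤ y := by
  induction t generalizing x y with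
  | nil => exact h.elim
  | node _ l r ihl ihr =>
    rcases h with h | h | h
    · exact ihl h.2
    · exact h.1
    · exact h.2.1

theorem IsLeftDescendant.lt_numNodes {t : BinaryTree Unit} {x y : ℕ}
    (h : IsLeftDescendant t x y) : y < t.numNodes := by
  induction t generalizing x y with
  | nil => exact h.elim
  | node _ l r ihl ihr =>
    simp only [BinaryTree.numNodes]
    rcases h with h | h | h
    · omega
    · omega
    · have := ihr h.2.2
      omega

/-- The root is the last interior vertex whose left subtree, with the vertex itself, reaches as far
as the leftmost interior vertex; so the relation of left descendance determines the tree. -/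
theorem isLeftDescendant_injective {s t : BinaryTree Unit}
    (h : ∀ x y, IsLeftDescendant s x y ↔ IsLeftDescendant t x y) : s = t := by
  induction s generalizing t with
  | nil =>
    cases t with
    | nil => rfl
    | node _ l r => exact ((h l.numNodes l.numNodes).2 (.inr (.inl ⟨le_rfl, rfl⟩))).elim
  | node _ l r ihl ihr =>
    cases t with
    | nil => exact ((h l.numNodes l.numNodes).1 (.inr (.inl ⟨le_rfl, rfl⟩))).elim
    | node _ l' r' =>
      have key : l.numNodes = l'.numNodes := by
        have h₁ := (h 0 l.numNodes).1 (.inr (.inl ⟨Nat.zero_le _, rfl⟩))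
        have h₂ := (h 0 l'.numNodes).2 (.inr (.inl ⟨Nat.zero_le _, rfl⟩))
        simp only [IsLeftDescendant] at h₁ h₂
        omega
      have hl : l = l' := ihl fun x y => by
        have hxy := h x y
        simp only [IsLeftDescendant] at hxy
        constructor
        · intro hd
          have h₁ := hd.lt_numNodes
          have h₂ := hd.le
          rcases hxy.1 (.inl ⟨h₁, hd⟩) with h | h | h
          · exact h.2
          · omega
          · omega
        · intro hd
          have h₁ := hd.lt_numNodes
          have h₂ := hd.le
          rcases hxy.2 (.inl ⟨h₁, hd⟩) with h | h | h
          · exact h.2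
          · omega
          · omega
      have hr : r = r' := ihr fun x y => by
        have hxy := h (x + (l.numNodes + 1)) (y + (l.numNodes + 1))
        simp only [IsLeftDescendant, ← key, Nat.add_sub_cancel] at hxy
        constructor
        · intro hd
          have h₂ := hd.le
          rcases hxy.1 (.inr (.inr ⟨by omega, by omega, hd⟩)) with h | h | h
          · omega
          · omega
          · exact h.2.2
        · intro hd
          have h₂ := hd.le
          rcases hxy.2 (.inr (.inr ⟨by omega, by omega, hd⟩)) with h | h | h
          · omega
          · omega
          · exact h.2.2
      rw [hl, hr]

omit [LinearOrder α] in
theorem numNodes_shape (t : BinaryTree α) : (shape t).numNodes = t.numNodes := by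
  induction t with
  | nil => rfl
  | node a l r ihl ihr =>
    simp only [shape, BinaryTree.map, BinaryTree.numNodes] at *
    rw [ihl, ihr]

omit [LinearOrder α] in
theorem length_labels (t : BinaryTree α) : (labels t).length = t.numNodes := by
  induction t with
  | nil => rfl
  | node a l r ihl ihr =>
    simp only [labels, BinaryTree.numNodes, List.length_append, List.length_cons, ihl, ihr]
    omega

omit [LinearOrder α] in
/-- The caret labels of a tree are the entries of the list of its labels, followed by `*`s. -/
theorem caretLabel_eq_getElem? (t : BinaryTree α) (i : ℕ) :
    caretLabel t i = (labels t)[i]?.elim ⊤ WithTop.some := by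
  induction t generalizing i with
  | nil => rfl
  | node a l r ihl ihr =>
    simp only [caretLabel, labels, List.getElem?_append, length_labels]
    split_ifs with h₁ h₂
    · exact ihl i
    · subst h₂
      simp
    · rw [ihr, ← Nat.sub_sub, List.getElem?_cons, if_neg (by omega)]

omit [LinearOrder α] in
theorem caretLabel_eq_top_iff {t : BinaryTree α} {i : ℕ} :
    caretLabel t i = ⊤ ↔ t.numNodes ≤ i := by
  rw [caretLabel_eq_getElem?, ← length_labels, ← List.getElem?_eq_none_iff]
  cases (labels t)[i]? <;> simp

omit [LinearOrder α] in
theorem caretLabel_eq_coe_iff {t : BinaryTree α} {i : ℕ} {a : α} :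
    caretLabel t i = a ↔ (labels t)[i]? = some a := by
  rw [caretLabel_eq_getElem?]
  cases (labels t)[i]? <;> simp

omit [LinearOrder α] in
theorem mem_labels_iff {t : BinaryTree α} {a : α} :
    a ∈ labels t ↔ ∃ i, caretLabel t i = a := by
  simp only [caretLabel_eq_coe_iff, List.mem_iff_getElem?]

theorem caretLabel_lt_of_forall_labels_lt {t : BinaryTree α} {a : α}
    (h : ∀ b ∈ labels t, b < a) {i : ℕ} (hi : i < t.numNodes) : caretLabel t i < a := by
  cases hc : caretLabel t i with
  | top => exact absurd (caretLabel_eq_top_iff.1 hc) (by omega)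
  | coe b => exact WithTop.coe_lt_coe.2 (h b (mem_labels_iff.2 ⟨i, hc⟩))

/-- In a decreasing tree, left domination of the caret labels is left descendance, and hence depends
on the shape of the tree only. -/
theorem leftDominates_caretLabel_iff {t : BinaryTree α} (ht : IsDecreasing t) {x y : ℕ} :
    LeftDominates (caretLabel t) x y ↔ IsLeftDescendant (shape t) x y := by
  induction t generalizing x y with
  | nil => simp [LeftDominates, IsLeftDescendant, shape, BinaryTree.map, caretLabel]
  | node a l r ihl ihr =>
    obtain ⟨hla, hra, hl, hr⟩ := ht
    have hshape : shape (.node a l r) = .node () (shape l) (shape r) := rfl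
    simp only [hshape, IsLeftDescendant, numNodes_shape, ← ihl hl, ← ihr hr]
    have c₁ : ∀ i, i < l.numNodes → caretLabel (.node a l r) i = caretLabel l i :=
      fun i hi => by simp only [caretLabel, if_pos hi]
    have c₂ : caretLabel (.node a l r) l.numNodes = a := by simp [caretLabel]
    have c₃ : ∀ i, caretLabel (.node a l r) (i + (l.numNodes + 1)) = caretLabel r i := fun i => by
      simp only [caretLabel]
      rw [if_neg (by omega), if_neg (by omega), Nat.add_sub_cancel]
    rcases lt_trichotomy y l.numNodes with hy | rfl | hy
    · have : LeftDominates (caretLabel (.node a l r)) x y ↔ LeftDominates (caretLabel l) x y := by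
        simp only [LeftDominates, c₁ y hy]
        refine and_congr_right fun _ => and_congr_right fun _ =>
          forall_congr' fun z => imp_congr_right fun _ => imp_congr_right fun hz => ?_
        rw [c₁ z (hz.trans hy)]
      rw [this]
      constructor
      · exact fun h => .inl ⟨hy, h⟩
      · rintro (h | h | h)
        · exact h.2
        · omega
        · omega
    · constructor
      · exact fun h => .inr (.inl ⟨h.1, rfl⟩)
      · rintro (h | h | h)
        · omega
        · refine ⟨h.1, by simp [c₂], fun z _ hz => ?_⟩
          rw [c₁ z hz, c₂]
          exact caretLabel_lt_of_forall_labels_lt hla hz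
        · omega
    · obtain ⟨y, rfl⟩ : ∃ y', y = y' + (l.numNodes + 1) := ⟨y - (l.numNodes + 1), by omega⟩
      by_cases hx : x ≤ l.numNodes
      · refine iff_of_false (fun h => ?_) (by omega)
        -- The root lies between the two carets, and its label is the largest one.
        have h₁ := h.2.2 l.numNodes hx (by omega)
        have h₂ := h.2.1
        rw [c₃] at h₁ h₂
        rw [c₂] at h₁
        have hyr : y < r.numNodes := by
          by_contra hyr
          exact h₂ (caretLabel_eq_top_iff.2 (by omega))
        exact lt_asymm h₁ (caretLabel_lt_of_forall_labels_lt hra hyr)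
      · obtain ⟨x, rfl⟩ : ∃ x', x = x' + (l.numNodes + 1) := ⟨x - (l.numNodes + 1), by omega⟩
        have : LeftDominates (caretLabel (.node a l r)) (x + (l.numNodes + 1))
            (y + (l.numNodes + 1)) ↔ LeftDominates (caretLabel r) x y := by
          simp only [LeftDominates, c₃]
          refine and_congr (by omega) (and_congr_right fun _ => ⟨fun h z h₁ h₂ => ?_,
            fun h z h₁ h₂ => ?_⟩)
          · rw [← c₃]
            exact h _ (by omega) (by omega)
          · obtain ⟨z, rfl⟩ : ∃ z', z = z' + (l.numNodes + 1) :=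
              ⟨z - (l.numNodes + 1), by omega⟩
            rw [c₃]
            exact h z (by omega) (by omega)
        rw [this]
        simp only [Nat.add_sub_cancel]
        constructor
        · exact fun h => .inr (.inr ⟨by omega, by have := h.1; omega, h⟩)
        · rintro (h | h | h)
          · omega
          · omega
          · exact h.2.2

theorem shape_eq_iff {s t : BinaryTree α} (hs : IsDecreasing s) (ht : IsDecreasing t) :
    shape s = shape t ↔
      ∀ x y, LeftDominates (caretLabel s) x y ↔ LeftDominates (caretLabel t) x y := by
  simp only [leftDominates_caretLabel_iff hs, leftDominates_caretLabel_iff ht]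
  exact ⟨fun h => by simp [h], isLeftDescendant_injective⟩

/-- The tree is obtained by splitting the list at its largest entry. -/
theorem exists_isDecreasing_labels_eq (l : List α) (hl : l.Nodup) :
    ∃ t : BinaryTree α, IsDecreasing t ∧ labels t = l := by
  induction hn : l.length using Nat.strong_induction_on generalizing l with
  | _ n ih =>
    rcases eq_or_ne l [] with rfl | hne
    · exact ⟨.nil, trivial, rfl⟩
    · obtain ⟨m, hm, hmax⟩ := l.toFinset.exists_max_image id (List.toFinset_nonempty_iff l |>.2 hne)
      simp only [List.mem_toFinset, id] at hm hmax
      obtain ⟨l₁, l₂, rfl⟩ := List.append_of_mem hm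
      rw [List.nodup_middle, List.nodup_cons] at hl
      have hlt : ∀ b ∈ l₁ ++ l₂, b < m := fun b hb =>
        lt_of_le_of_ne (hmax b (by simp at hb ⊢; tauto)) (by rintro rfl; exact hl.1 hb)
      simp only [List.length_append, List.length_cons] at hn
      obtain ⟨t₁, ht₁, rfl⟩ := ih _ (by omega) l₁ (List.Nodup.of_append_left hl.2) rfl
      obtain ⟨t₂, ht₂, rfl⟩ := ih _ (by omega) l₂ (List.Nodup.of_append_right hl.2) rfl
      exact ⟨.node m t₁ t₂, ⟨fun b hb => hlt b (List.mem_append_left _ hb),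
        fun b hb => hlt b (List.mem_append_right _ hb), ht₁, ht₂⟩, rfl⟩

/-- A permutation, continued by `*` to the right of its last position. -/
def permEntry {n : ℕ} (σ : Equiv.Perm (Fin n)) (i : ℕ) : WithTop (Fin n) :=
  if h : i < n then (σ ⟨i, h⟩ : WithTop (Fin n)) else ⊤

theorem LinTree.numNodes_eq {n : ℕ} (t : LinTree n) : t.tree.numNodes = n := by
  rw [← length_labels, ← List.toFinset_card_of_nodup t.nodup,
    (Finset.eq_univ_iff_forall (s := (labels t.tree).toFinset)).2 (by simpa using t.exhaust)]
  simp

theorem LinTree.Represents.caretLabel_eq {n : ℕ} {t : LinTree n} {σ : Equiv.Perm (Fin n)}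
    (h : t.Represents σ) : caretLabel t.tree = permEntry σ := by
  funext i
  by_cases hi : i < n
  · simpa [permEntry, hi] using h ⟨i, hi⟩
  · simp only [permEntry, hi, dite_false, caretLabel_eq_top_iff, t.numNodes_eq]
    omega

theorem exists_linTree_represents {n : ℕ} (σ : Equiv.Perm (Fin n)) :
    ∃ t : LinTree n, t.Represents σ := by
  obtain ⟨t, ht, hl⟩ := exists_isDecreasing_labels_eq (List.ofFn σ) (List.nodup_ofFn.2 σ.injective)
  refine ⟨⟨t, ht, hl ▸ List.nodup_ofFn.2 σ.injective, fun j => ?_⟩, fun i => ?_⟩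
  · rw [hl, List.mem_ofFn]
    exact σ.surjective j
  · rw [caretLabel_eq_coe_iff, hl]
    simp

theorem permEquiv_iff_leftDominates {n : ℕ} {σ ρ : Equiv.Perm (Fin n)} :
    PermEquiv σ ρ ↔ ∀ x y, LeftDominates (permEntry σ) x y ↔ LeftDominates (permEntry ρ) x y := by
  constructor
  · rintro ⟨s, t, hs, ht, h⟩
    rwa [shape_eq_iff s.decreasing t.decreasing, hs.caretLabel_eq, ht.caretLabel_eq] at h
  · intro h
    obtain ⟨s, hs⟩ := exists_linTree_represents σ
    obtain ⟨t, ht⟩ := exists_linTree_represents ρ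
    refine ⟨s, t, hs, ht, ?_⟩
    rwa [shape_eq_iff s.decreasing t.decreasing, hs.caretLabel_eq, ht.caretLabel_eq]

end Trees

/-! ### Decreasing forests -/

section Forests

variable {α : Type*}

/-- The number of the first leaf of the `r`-th tree of a forest. -/
def treeOffset (f : ℕ → BinaryTree α) (r : ℕ) : ℕ :=
  ∑ q ∈ Finset.range r, ((f q).numNodes + 1)

theorem treeOffset_succ (f : ℕ → BinaryTree α) (r : ℕ) :
    treeOffset f (r + 1) = treeOffset f r + ((f r).numNodes + 1) :=
  Finset.sum_range_succ _ _

theorem treeOffset_succ' (f : ℕ → BinaryTree α) (r : ℕ) :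
    treeOffset f (r + 1) = treeOffset (fun q => f (q + 1)) r + ((f 0).numNodes + 1) :=
  Finset.sum_range_succ' _ _

theorem gapLabel_of_le {f : ℕ → BinaryTree α} {i : ℕ} (h : i ≤ (f 0).numNodes) :
    gapLabel f i = caretLabel (f 0) i := by
  rw [gapLabel, if_pos h]

theorem gapLabel_add (f : ℕ → BinaryTree α) (i : ℕ) :
    gapLabel f (i + ((f 0).numNodes + 1)) = gapLabel (fun r => f (r + 1)) i := by
  rw [gapLabel, if_neg (by omega), Nat.add_sub_cancel]

theorem gapLabel_treeOffset_add {f : ℕ → BinaryTree α} {r i : ℕ} (hi : i ≤ (f r).numNodes) :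
    gapLabel f (treeOffset f r + i) = caretLabel (f r) i := by
  induction r generalizing f with
  | zero => simpa [treeOffset] using gapLabel_of_le hi
  | succ r ih =>
    rw [treeOffset_succ', add_right_comm, gapLabel_add, ih hi]

theorem exists_eq_treeOffset_add (f : ℕ → BinaryTree α) (p : ℕ) :
    ∃ r i, i ≤ (f r).numNodes ∧ p = treeOffset f r + i := by
  induction p with
  | zero => exact ⟨0, 0, Nat.zero_le _, rfl⟩
  | succ p ih =>
    obtain ⟨r, i, hi, rfl⟩ := ih
    rcases hi.eq_or_lt with rfl | hi
    · exact ⟨r + 1, 0, Nat.zero_le _, by rw [treeOffset_succ]; omega⟩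
    · exact ⟨r, i + 1, hi, by omega⟩

theorem treeOffset_add_injective {f : ℕ → BinaryTree α} {r r' i i' : ℕ}
    (hi : i ≤ (f r).numNodes) (hi' : i' ≤ (f r').numNodes)
    (h : treeOffset f r + i = treeOffset f r' + i') : r = r' := by
  have hm : Monotone (treeOffset f) := monotone_nat_of_le_succ fun q => by
    rw [treeOffset_succ]
    omega
  by_contra hne
  rcases lt_or_gt_of_ne hne with hlt | hlt <;> have := hm (Nat.succ_le_of_lt hlt) <;>
    rw [Nat.succ_eq_add_one, treeOffset_succ] at this <;> omega

variable [LinearOrder α]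

theorem leftDominates_gapLabel_of_le {f : ℕ → BinaryTree α} {x y : ℕ}
    (hy : y ≤ (f 0).numNodes) :
    LeftDominates (gapLabel f) x y ↔ LeftDominates (caretLabel (f 0)) x y := by
  simp only [LeftDominates, gapLabel_of_le hy]
  refine and_congr_right fun _ => and_congr_right fun _ =>
    forall_congr' fun z => imp_congr_right fun _ => imp_congr_right fun hz => ?_
  rw [gapLabel_of_le (hz.le.trans hy)]

theorem leftDominates_gapLabel_add {f : ℕ → BinaryTree α} {x y : ℕ} :
    LeftDominates (gapLabel f) (x + ((f 0).numNodes + 1)) (y + ((f 0).numNodes + 1)) ↔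
      LeftDominates (gapLabel fun r => f (r + 1)) x y := by
  simp only [LeftDominates, gapLabel_add]
  refine and_congr (by omega) (and_congr_right fun _ => ⟨fun h z h₁ h₂ => ?_, fun h z h₁ h₂ => ?_⟩)
  · rw [← gapLabel_add]
    exact h _ (by omega) (by omega)
  · obtain ⟨z, rfl⟩ : ∃ z', z = z' + ((f 0).numNodes + 1) := ⟨z - ((f 0).numNodes + 1), by omega⟩
    rw [gapLabel_add]
    exact h z (by omega) (by omega)

/-- The gap between two consecutive trees is not covered, so no left domination extends over it. -/
theorem not_leftDominates_gapLabel {f : ℕ → BinaryTree α} {x y : ℕ} (hx : x ≤ (f 0).numNodes)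
    (hy : (f 0).numNodes ≤ y) : ¬ LeftDominates (gapLabel f) x y := by
  have htop : gapLabel f (f 0).numNodes = ⊤ := by
    rw [gapLabel_of_le le_rfl, caretLabel_eq_top_iff]
  intro h
  rcases hy.eq_or_lt with rfl | hy
  · exact h.2.1 htop
  · have := h.2.2 _ hx hy
    rw [htop] at this
    exact not_top_lt this

/-- Left domination of the gap labels is determined by the shape of a decreasing forest, and
conversely. -/
theorem forall_shape_eq_iff {f g : ℕ → BinaryTree α} (hf : ∀ r, IsDecreasing (f r))
    (hg : ∀ r, IsDecreasing (g r)) :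
    (∀ r, shape (f r) = shape (g r)) ↔
      ∀ x y, LeftDominates (gapLabel f) x y ↔ LeftDominates (gapLabel g) x y := by
  constructor
  · intro h x
    induction x using Nat.strong_induction_on generalizing f g with
    | _ x ih =>
      intro y
      have hN : (f 0).numNodes = (g 0).numNodes := by
        rw [← numNodes_shape, h 0, numNodes_shape]
      by_cases hxy : x ≤ y
      swap
      · exact iff_of_false (fun h => hxy h.1) fun h => hxy h.1
      by_cases hx : x ≤ (f 0).numNodes
      · by_cases hy : y < (f 0).numNodes
        · rw [leftDominates_gapLabel_of_le hy.le, leftDominates_gapLabel_of_le (hN ▸ hy.le)]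
          exact (shape_eq_iff (hf 0) (hg 0)).1 (h 0) x y
        · exact iff_of_false (not_leftDominates_gapLabel hx (not_lt.1 hy))
            (not_leftDominates_gapLabel (hN ▸ hx) (hN ▸ not_lt.1 hy))
      · obtain ⟨x, rfl⟩ : ∃ z, x = z + ((f 0).numNodes + 1) := ⟨x - ((f 0).numNodes + 1), by omega⟩
        obtain ⟨y, rfl⟩ : ∃ z, y = z + ((f 0).numNodes + 1) := ⟨y - ((f 0).numNodes + 1), by omega⟩
        rw [leftDominates_gapLabel_add, hN, leftDominates_gapLabel_add]
        exact ih x (by omega) (fun r => hf (r + 1)) (fun r => hg (r + 1)) (fun r => h (r + 1)) y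
  · intro h r
    have aux : ∀ {f g : ℕ → BinaryTree α},
        (∀ x y, LeftDominates (gapLabel f) x y ↔ LeftDominates (gapLabel g) x y) →
        (f 0).numNodes ≤ (g 0).numNodes := by
      intro f g h
      by_contra! hlt
      have hd : LeftDominates (gapLabel f) (g 0).numNodes (g 0).numNodes := by
        refine ⟨le_rfl, ?_, fun z h₁ h₂ => absurd h₁ (not_le.2 h₂)⟩
        rw [gapLabel_of_le hlt.le, Ne, caretLabel_eq_top_iff]
        omega
      exact not_leftDominates_gapLabel le_rfl le_rfl ((h _ _).1 hd)
    induction r generalizing f g with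
    | zero =>
      have hN : (f 0).numNodes = (g 0).numNodes :=
        le_antisymm (aux h) (aux fun x y => (h x y).symm)
      refine (shape_eq_iff (hf 0) (hg 0)).2 fun x y => ?_
      by_cases hy : y ≤ (f 0).numNodes
      · rw [← leftDominates_gapLabel_of_le hy, h, leftDominates_gapLabel_of_le (hN ▸ hy)]
      · exact iff_of_false (fun h => h.2.1 (caretLabel_eq_top_iff.2 (by omega)))
          (fun h => h.2.1 (caretLabel_eq_top_iff.2 (by omega)))
    | succ r ih =>
      have hN : (f 0).numNodes = (g 0).numNodes :=
        le_antisymm (aux h) (aux fun x y => (h x y).symm)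
      refine ih (fun r => hf (r + 1)) (fun r => hg (r + 1)) fun x y => ?_
      rw [← leftDominates_gapLabel_add (f := f), ← leftDominates_gapLabel_add (f := g), ← hN]
      exact h _ _

/-- The tree is the one whose labels are the entries before the first `*`. -/
theorem exists_isDecreasing_caretLabel_eq {φ : ℕ → WithTop α}
    (hφ : ∀ i j, φ i = φ j → φ i ≠ ⊤ → i = j) (htop : ∃ y, φ y = ⊤) :
    ∃ t : BinaryTree α, IsDecreasing t ∧ ∀ i ≤ t.numNodes, caretLabel t i = φ i := by
  classical
  let z := Nat.find htop
  let l : Fin z → α := fun i => (φ i).untop (Nat.find_min htop i.2)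
  have hl : ∀ i, (l i : WithTop α) = φ i := fun i => WithTop.coe_untop _ _
  have hinj : Function.Injective l := fun i j hij => Fin.ext
    (hφ i j (by rw [← hl, ← hl, hij]) (Nat.find_min htop i.2))
  obtain ⟨t, ht, hlt⟩ := exists_isDecreasing_labels_eq (List.ofFn l) (List.nodup_ofFn.2 hinj)
  have hz : t.numNodes = z := by rw [← length_labels, hlt, List.length_ofFn]
  refine ⟨t, ht, fun i hi => ?_⟩
  rw [hz] at hi
  rcases hi.eq_or_lt with rfl | hi
  · rw [caretLabel_eq_top_iff.2 hz.le]
    exact (Nat.find_spec htop).symm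
  · rw [← hl ⟨i, hi⟩, caretLabel_eq_coe_iff, hlt]
    simp [hi]

/-- Every sequence with infinitely many `*` and without repeated labels is the sequence of the gap
labels of a decreasing forest: cut it at the `*`s. -/
theorem exists_isDecreasing_gapLabel_eq {φ : ℕ → WithTop α}
    (hφ : ∀ i j, φ i = φ j → φ i ≠ ⊤ → i = j) (htop : ∀ x, ∃ y, x ≤ y ∧ φ y = ⊤) :
    ∃ f : ℕ → BinaryTree α, (∀ r, IsDecreasing (f r)) ∧ gapLabel f = φ := by
  let S := {φ : ℕ → WithTop α //
    (∀ i j, φ i = φ j → φ i ≠ ⊤ → i = j) ∧ ∀ x, ∃ y, x ≤ y ∧ φ y = ⊤}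
  have hS : ∀ s : S, ∃ t : BinaryTree α, IsDecreasing t ∧ ∀ i ≤ t.numNodes,
      caretLabel t i = s.1 i := fun s =>
    exists_isDecreasing_caretLabel_eq s.2.1 ((s.2.2 0).imp fun _ h => h.2)
  choose t ht hts using hS
  -- `shift s` is what remains of `s` after its first tree and the `*` that follows it.
  let shift : S → S := fun s => ⟨fun i => s.1 (i + ((t s).numNodes + 1)), fun i j h h' =>
    Nat.add_right_cancel (s.2.1 _ _ h h'), fun x => by
      obtain ⟨y, hxy, hy⟩ := s.2.2 (x + ((t s).numNodes + 1))
      refine ⟨y - ((t s).numNodes + 1), by omega, ?_⟩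
      change s.1 (y - ((t s).numNodes + 1) + ((t s).numNodes + 1)) = ⊤
      rwa [Nat.sub_add_cancel (by omega)]⟩
  refine ⟨fun r => t (shift^[r] ⟨φ, hφ, htop⟩), fun r => ht _, ?_⟩
  suffices h : ∀ i, ∀ s : S, gapLabel (fun r => t (shift^[r] s)) i = s.1 i from
    funext fun i => h i ⟨φ, hφ, htop⟩
  intro i
  induction i using Nat.strong_induction_on with
  | _ i ih =>
    intro s
    by_cases hi : i ≤ (t s).numNodes
    · rw [gapLabel_of_le (f := fun r => t (shift^[r] s)) hi]
      exact hts s i hi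
    · obtain ⟨i, rfl⟩ : ∃ j, i = j + ((t s).numNodes + 1) := ⟨i - ((t s).numNodes + 1), by omega⟩
      exact (gapLabel_add (fun r => t (shift^[r] s)) i).trans (ih i (by omega) (shift s))

/-- The values of a `∗`-permutation, with the positions numbered from `0`. -/
def starEntry {n : ℕ} (σ : StarPerm n) (i : ℕ) : WithTop (Fin n) :=
  σ.1 i.succPNat

theorem LinForest.represents_iff {n : ℕ} {f : LinForest n} {σ : StarPerm n} :
    f.Represents σ ↔ gapLabel f.tree = starEntry σ := by
  constructor
  · intro h
    funext i
    simpa [starEntry] using h i.succPNat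
  · intro h p
    rw [h, starEntry, PNat.succPNat_natPred]

theorem starEntry_injective {n : ℕ} (σ : StarPerm n) {i j : ℕ}
    (h : starEntry σ i = starEntry σ j) (hi : starEntry σ i ≠ ⊤) : i = j := by
  obtain ⟨a, ha⟩ := WithTop.ne_top_iff_exists.1 hi
  exact Nat.succPNat_injective ((σ.2 a).unique ha.symm (h.symm.trans ha.symm))

theorem exists_starEntry_eq_top {n : ℕ} (σ : StarPerm n) (x : ℕ) :
    ∃ y, x ≤ y ∧ starEntry σ y = ⊤ := by
  have hfin : (starEntry σ ⁻¹' {⊤}ᶜ).Finite :=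
    (Set.toFinite _).preimage fun i hi j _ h => starEntry_injective σ h hi
  obtain ⟨y, hy, hxy⟩ := hfin.infinite_compl.exists_gt x
  exact ⟨y, hxy.le, by simpa using hy⟩

theorem exists_linForest_represents {n : ℕ} (σ : StarPerm n) :
    ∃ f : LinForest n, f.Represents σ := by
  obtain ⟨f, hf, hσ⟩ := exists_isDecreasing_gapLabel_eq (φ := starEntry σ)
    (fun _ _ => starEntry_injective σ) (exists_starEntry_eq_top σ)
  have hlt : ∀ {r i : ℕ} {a : Fin n}, caretLabel (f r) i = a → i ≤ (f r).numNodes := by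
    intro r i a h
    by_contra hi
    rw [caretLabel_eq_top_iff.2 (by omega)] at h
    exact WithTop.top_ne_coe h
  have hentry : ∀ {r i : ℕ} {a : Fin n}, caretLabel (f r) i = a →
      starEntry σ (treeOffset f r + i) = a := fun h => by
    rw [← hσ, gapLabel_treeOffset_add (hlt h), h]
  have huniq : ∀ {r i r' i' : ℕ} {a : Fin n}, caretLabel (f r) i = a → caretLabel (f r') i' = a →
      treeOffset f r + i = treeOffset f r' + i' := fun h h' =>
    starEntry_injective σ ((hentry h).trans (hentry h').symm) (by simp [hentry h])
  refine ⟨⟨f, hf, fun r => ?_, fun j => ?_⟩, LinForest.represents_iff.2 hσ⟩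
  · rw [List.nodup_iff_injective_get]
    intro i j hij
    have hi : ∀ k : Fin (labels (f r)).length,
        caretLabel (f r) k = ((labels (f r)).get k : WithTop (Fin n)) := fun k => by
      rw [caretLabel_eq_coe_iff]
      simp
    have := huniq (hi i) ((hi j).trans (by rw [hij]))
    exact Fin.ext (by omega)
  · obtain ⟨p, hp, -⟩ := σ.2 j
    obtain ⟨r, i, hi, hpr⟩ := exists_eq_treeOffset_add f p.natPred
    refine ⟨r, mem_labels_iff.2 ⟨i, ?_⟩, fun r' hr' => ?_⟩
    · rw [← gapLabel_treeOffset_add hi, ← hpr, hσ, starEntry, PNat.succPNat_natPred, hp]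
    · obtain ⟨i', hi'⟩ := mem_labels_iff.1 hr'
      refine treeOffset_add_injective (hlt hi') hi ?_
      rw [← hpr]
      refine starEntry_injective σ ?_ (by simp [hentry hi'])
      rw [hentry hi', starEntry, PNat.succPNat_natPred, hp]

theorem starEquiv_iff_leftDominates {n : ℕ} {σ ρ : StarPerm n} :
    StarEquiv σ ρ ↔ ∀ x y, LeftDominates (starEntry σ) x y ↔ LeftDominates (starEntry ρ) x y := by
  constructor
  · rintro ⟨f, g, hf, hg, h⟩
    rwa [forall_shape_eq_iff f.decreasing g.decreasing, LinForest.represents_iff.1 hf,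
      LinForest.represents_iff.1 hg] at h
  · intro h
    obtain ⟨f, hf⟩ := exists_linForest_represents σ
    obtain ⟨g, hg⟩ := exists_linForest_represents ρ
    refine ⟨f, g, hf, hg, ?_⟩
    rwa [forall_shape_eq_iff f.decreasing g.decreasing, LinForest.represents_iff.1 hf,
      LinForest.represents_iff.1 hg]

end Forests

/-! ### The weak Bruhat order as inclusion of inversion sets -/

section WeakOrder

variable {n : ℕ}

/-- The positions `a < b` form an inversion of `σ`. -/
def Inverted (σ : Equiv.Perm (Fin n)) (a b : Fin n) : Prop :=
  a < b ∧ σ b < σ a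

instance (σ : Equiv.Perm (Fin n)) (a b : Fin n) : Decidable (Inverted σ a b) :=
  inferInstanceAs (Decidable (_ ∧ _))

/-- The set of all inversions of `σ`. -/
def inversions (σ : Equiv.Perm (Fin n)) : Finset (Fin n × Fin n) :=
  {p | Inverted σ p.1 p.2}

theorem mem_inversions {σ : Equiv.Perm (Fin n)} {a b : Fin n} :
    (a, b) ∈ inversions σ ↔ Inverted σ a b := by
  simp [inversions]

theorem Inverted.trans {σ : Equiv.Perm (Fin n)} {a b c : Fin n} (hab : Inverted σ a b)
    (hbc : Inverted σ b c) : Inverted σ a c :=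
  ⟨hab.1.trans hbc.1, hbc.2.trans hab.2⟩

theorem Inverted.or_of_between {σ : Equiv.Perm (Fin n)} {a b c : Fin n} (h : Inverted σ a c)
    (hab : a < b) (hbc : b < c) : Inverted σ a b ∨ Inverted σ b c := by
  rcases lt_or_ge (σ b) (σ a) with hb | hb
  · exact .inl ⟨hab, hb⟩
  · exact .inr ⟨hbc, h.2.trans_le hb⟩

theorem not_inverted_iff {σ : Equiv.Perm (Fin n)} {a b : Fin n} (hab : a < b) :
    ¬ Inverted σ a b ↔ σ a < σ b := by
  simp only [Inverted, hab, true_and, not_lt]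
  exact ⟨fun h => lt_of_le_of_ne h (σ.injective.ne hab.ne), le_of_lt⟩

theorem eq_of_inverted_iff {σ ρ : Equiv.Perm (Fin n)}
    (h : ∀ a b, Inverted σ a b ↔ Inverted ρ a b) : σ = ρ := by
  have hlt : ∀ a b, σ a < σ b → ρ a < ρ b := by
    intro a b hab
    rcases lt_trichotomy a b with h' | rfl | h'
    · rw [← not_inverted_iff h', ← h, not_inverted_iff h']
      exact hab
    · exact absurd hab (lt_irrefl _)
    · exact ((h b a).1 ⟨h', hab⟩).2
  have hm : StrictMono (ρ * σ⁻¹) := fun a b hab => by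
    simpa using hlt (σ⁻¹ a) (σ⁻¹ b) (by simpa using hab)
  have h1 : ⇑(ρ * σ⁻¹) = id := by
    have := Subsingleton.elim (StrictMono.orderIsoOfSurjective _ hm (ρ * σ⁻¹).surjective)
      (OrderIso.refl (Fin n))
    exact congrArg (fun e : Fin n ≃o Fin n => (e : Fin n → Fin n)) this
  have h2 : ρ * σ⁻¹ = 1 := Equiv.ext (congrFun h1)
  exact (mul_inv_eq_one.1 h2).symm

theorem swap_lt_swap_iff {i j : Fin n} (hij : (j : ℕ) = i + 1) (u v : Fin n) :
    Equiv.swap i j u < Equiv.swap i j v ↔ (u < v ∧ ¬ (u = i ∧ v = j)) ∨ (u = j ∧ v = i) := by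
  simp only [Equiv.swap_apply_def]
  split_ifs <;> simp only [Fin.ext_iff, Fin.lt_def] at * <;> omega

/-- `ρ` arises from `σ` by exchanging two adjacent values `i` and `i + 1` of which the smaller one
stands further to the left. -/
def IsAscentSwap (σ ρ : Equiv.Perm (Fin n)) : Prop :=
  ∃ a b : Fin n, a < b ∧ (σ b : ℕ) = σ a + 1 ∧ ρ = Equiv.swap (σ a) (σ b) * σ

theorem inverted_swap_mul_iff {σ : Equiv.Perm (Fin n)} {a b : Fin n} (hab : a < b)
    (h : (σ b : ℕ) = σ a + 1) (x y : Fin n) :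
    Inverted (Equiv.swap (σ a) (σ b) * σ) x y ↔ Inverted σ x y ∨ (x = a ∧ y = b) := by
  simp only [Inverted, Equiv.Perm.mul_apply, swap_lt_swap_iff h, σ.injective.eq_iff]
  constructor
  · tauto
  · rintro (h' | ⟨rfl, rfl⟩)
    · refine ⟨h'.1, .inl ⟨h'.2, ?_⟩⟩
      rintro ⟨rfl, rfl⟩
      exact lt_asymm hab h'.1
    · exact ⟨hab, .inr ⟨rfl, rfl⟩⟩

theorem IsAscentSwap.card_inversions {σ ρ : Equiv.Perm (Fin n)} (h : IsAscentSwap σ ρ) :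
    (inversions ρ).card = (inversions σ).card + 1 := by
  obtain ⟨a, b, hab, h, rfl⟩ := h
  have hnot : (a, b) ∉ inversions σ := by
    rw [mem_inversions, not_inverted_iff hab, Fin.lt_def]
    omega
  rw [← Finset.card_insert_of_notMem hnot]
  congr 1
  ext ⟨x, y⟩
  rw [mem_inversions, inverted_swap_mul_iff hab h, Finset.mem_insert, mem_inversions,
    Prod.mk.injEq, or_comm]

/-- Multiplication by a standard generator changes the number of inversions by one, up or down. -/
theorem IsStandardReflection.isAscentSwap_or {s : Equiv.Perm (Fin n)} (hs : IsStandardReflection s)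
    (σ : Equiv.Perm (Fin n)) : IsAscentSwap σ (s * σ) ∨ IsAscentSwap (s * σ) σ := by
  obtain ⟨i, j, hij, rfl⟩ := hs
  have hne : i ≠ j := by
    rintro rfl
    omega
  rcases lt_or_gt_of_ne (σ⁻¹.injective.ne hne) with h | h
  · exact .inl ⟨σ⁻¹ i, σ⁻¹ j, h, by simpa using hij, by simp⟩
  · exact .inr ⟨σ⁻¹ j, σ⁻¹ i, h, by simpa using hij, by simp [← mul_assoc]⟩

theorem IsAscentSwap.exists_reflection {σ ρ : Equiv.Perm (Fin n)} (h : IsAscentSwap σ ρ) :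
    ∃ s, IsStandardReflection s ∧ ρ = s * σ := by
  obtain ⟨a, b, -, h, rfl⟩ := h
  exact ⟨_, ⟨σ a, σ b, h, rfl⟩, rfl⟩

/-- If all inversions of `σ` are inversions of `ρ ≠ σ`, then `ρσ⁻¹` is not increasing, and a descent
of it yields an inversion of `ρ` that can be added to those of `σ` by one adjacent exchange. -/
theorem reflTransGen_isAscentSwap {σ ρ : Equiv.Perm (Fin n)}
    (h : ∀ a b, Inverted σ a b → Inverted ρ a b) : Relation.ReflTransGen IsAscentSwap σ ρ := by
  induction hm : (inversions ρ).card - (inversions σ).card using Nat.strong_induction_on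
    generalizing σ with
  | _ m ih =>
    by_cases heq : ∀ i j : Fin n, (j : ℕ) = i + 1 → ρ (σ⁻¹ i) < ρ (σ⁻¹ j)
    · have hm : StrictMono (ρ * σ⁻¹) := by
        cases n with
        | zero => exact fun a => a.elim0
        | succ n =>
          rw [Fin.strictMono_iff_lt_succ]
          intro i
          exact heq _ _ (by simp)
      have : σ = ρ := eq_of_inverted_iff fun a b => ⟨h a b, fun hab => by
        refine ⟨hab.1, ?_⟩
        have := hm.lt_iff_lt (a := σ b) (b := σ a)
        simpa using this.1 (by simpa using hab.2)⟩
      rw [this]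
    · push Not at heq
      obtain ⟨i, j, hij, hle⟩ := heq
      obtain ⟨a, rfl⟩ := σ.surjective i
      obtain ⟨b, rfl⟩ := σ.surjective j
      simp only [Equiv.Perm.inv_def, Equiv.symm_apply_apply] at hle
      have hne : a ≠ b := by
        rintro rfl
        omega
      have hlt : ρ b < ρ a := lt_of_le_of_ne hle (ρ.injective.ne hne.symm)
      have hab : a < b := by
        by_contra hab
        have hba : b < a := lt_of_le_of_ne (not_lt.1 hab) hne.symm
        exact lt_asymm hlt (h b a ⟨hba, Fin.lt_def.2 (by omega)⟩).2
      have hstep : IsAscentSwap σ (Equiv.swap (σ a) (σ b) * σ) := ⟨a, b, hab, hij, rfl⟩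
      have hsub : ∀ x y, Inverted (Equiv.swap (σ a) (σ b) * σ) x y → Inverted ρ x y := by
        intro x y hxy
        rcases (inverted_swap_mul_iff hab hij x y).1 hxy with h' | ⟨rfl, rfl⟩
        · exact h x y h'
        · exact ⟨hab, hlt⟩
      have hcard := Finset.card_le_card (s := inversions (Equiv.swap (σ a) (σ b) * σ))
        (t := inversions ρ) fun p hp => mem_inversions.2 (hsub _ _ (mem_inversions.1 hp))
      rw [hstep.card_inversions] at hcard
      exact .head hstep (ih _ (by rw [hstep.card_inversions]; omega) hsub rfl)

theorem card_inversions_prod_le (w : List (Equiv.Perm (Fin n)))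
    (hw : ∀ s ∈ w, IsStandardReflection s) : (inversions w.prod).card ≤ w.length := by
  induction w with
  | nil =>
    simp only [List.prod_nil, List.length_nil, Nat.le_zero, Finset.card_eq_zero]
    ext ⟨a, b⟩
    simpa [mem_inversions, Inverted] using le_of_lt
  | cons s w ih =>
    have ih := ih fun t ht => hw t (List.mem_cons_of_mem _ ht)
    rw [List.prod_cons, List.length_cons]
    rcases (hw s List.mem_cons_self).isAscentSwap_or w.prod with h | h
    · rw [h.card_inversions]
      omega
    · have := h.card_inversions
      omega

theorem length_eq_card_inversions (σ : Equiv.Perm (Fin n)) :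
    length σ = (inversions σ).card := by
  have hchain : Relation.ReflTransGen IsAscentSwap 1 σ :=
    reflTransGen_isAscentSwap fun a b h => absurd h.2 (lt_asymm h.1)
  have hword : ∃ w : List (Equiv.Perm (Fin n)),
      (∀ s ∈ w, IsStandardReflection s) ∧ w.prod = σ ∧ w.length = (inversions σ).card := by
    induction hchain with
    | refl =>
      refine ⟨[], by simp, by simp, ?_⟩
      simpa [eq_comm] using card_inversions_prod_le (n := n) [] (by simp)
    | tail _ h ih =>
      obtain ⟨w, hw, hprod, hlen⟩ := ih
      obtain ⟨s, hs, hsσ⟩ := h.exists_reflection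
      exact ⟨s :: w, by simpa using ⟨hs, hw⟩, by rw [List.prod_cons, hprod, hsσ],
        by rw [List.length_cons, hlen, h.card_inversions]⟩
  refine le_antisymm (Nat.sInf_le hword) (le_csInf ⟨_, hword⟩ ?_)
  rintro l ⟨w, hw, rfl, rfl⟩
  exact card_inversions_prod_le w hw

theorem weakCover_iff_isAscentSwap {σ ρ : Equiv.Perm (Fin n)} :
    WeakCover σ ρ ↔ IsAscentSwap σ ρ := by
  simp only [WeakCover, length_eq_card_inversions]
  constructor
  · rintro ⟨⟨s, hs, rfl⟩, hlt⟩
    refine (hs.isAscentSwap_or σ).resolve_right fun h => ?_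
    have := h.card_inversions
    omega
  · intro h
    refine ⟨h.exists_reflection, ?_⟩
    have := h.card_inversions
    omega

theorem weakLE_iff {σ ρ : Equiv.Perm (Fin n)} :
    WeakLE σ ρ ↔ ∀ a b, Inverted σ a b → Inverted ρ a b := by
  have hcover : WeakCover (n := n) = IsAscentSwap := by
    funext σ ρ
    exact propext weakCover_iff_isAscentSwap
  rw [WeakLE, hcover]
  refine ⟨fun h => ?_, reflTransGen_isAscentSwap⟩
  induction h with
  | refl => exact fun _ _ => id
  | tail _ h ih =>
    obtain ⟨a, b, hab, h, rfl⟩ := h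
    exact fun x y hxy => (inverted_swap_mul_iff hab h x y).2 (.inl (ih x y hxy))

/-! ### Joins and meets in the weak Bruhat order -/

/-- The relation `T` is the inversion relation of the permutation that sorts the positions by the
linear order obtained from the usual one by reversing all pairs in `T`. -/
theorem exists_inverted_iff (T : Fin n → Fin n → Prop) (hlt : ∀ a b, T a b → a < b)
    (htrans : ∀ a b c, T a b → T b c → T a c)
    (hcotrans : ∀ a b c, a < b → b < c → T a c → T a b ∨ T b c) :
    ∃ σ : Equiv.Perm (Fin n), ∀ a b, Inverted σ a b ↔ T a b := by
  classical
  -- `R a b` says that `a` comes before `b` in the linear order, so that `σ a < σ b` is required.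
  let R : Fin n → Fin n → Prop := fun a b => (a < b ∧ ¬ T a b) ∨ T b a
  have Rirrefl : ∀ a, ¬ R a a := fun a h => h.elim (fun h => lt_irrefl _ h.1)
    fun h => lt_irrefl _ (hlt _ _ h)
  have Rtotal : ∀ a b, a ≠ b → R a b ∨ R b a := by
    intro a b hab
    rcases lt_or_gt_of_ne hab with h | h <;> by_cases h' : T a b <;> by_cases h'' : T b a <;>
      simp [R, h, h', h'']
  have Rtrans : ∀ a b c, R a b → R b c → R a c := by
    rintro a b c (⟨h₁, h₂⟩ | h₁) (⟨h₃, h₄⟩ | h₃)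
    · exact .inl ⟨h₁.trans h₃, fun h => (hcotrans a b c h₁ h₃ h).elim h₂ h₄⟩
    · have hcb := hlt _ _ h₃
      rcases lt_trichotomy a c with h | rfl | h
      · exact .inl ⟨h, fun h' => h₂ (htrans _ _ _ h' h₃)⟩
      · exact absurd h₃ h₂
      · exact .inr ((hcotrans c a b h h₁ h₃).resolve_right h₂)
    · have hba := hlt _ _ h₁
      rcases lt_trichotomy a c with h | rfl | h
      · exact .inl ⟨h, fun h' => h₄ (htrans _ _ _ h₁ h')⟩
      · exact absurd h₁ h₄
      · exact .inr ((hcotrans b c a h₃ h h₁).resolve_left h₄)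
    · exact .inr (htrans _ _ _ h₃ h₁)
  let rank : Fin n → ℕ := fun a => (Finset.univ.filter fun b => R b a).card
  have hrank : ∀ a b, R a b → rank a < rank b := fun a b h =>
    Finset.card_lt_card (Finset.ssubset_iff_of_subset
      (fun c hc => by simpa using Rtrans c a b (by simpa using hc) h) |>.2
      ⟨a, by simpa using h, by simpa using Rirrefl a⟩)
  have hbound : ∀ a, rank a < n := fun a => by
    have := Finset.card_lt_card (Finset.ssubset_iff_of_subset (Finset.subset_univ
      (Finset.univ.filter fun b => R b a)) |>.2 ⟨a, by simp, by simpa using Rirrefl a⟩)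
    simpa using this
  let f : Fin n → Fin n := fun a => ⟨rank a, hbound a⟩
  have hf : Function.Injective f := by
    intro a b hab
    by_contra hne
    have hab : rank a = rank b := congrArg Fin.val hab
    rcases Rtotal a b hne with h | h <;> have := hrank _ _ h <;> omega
  refine ⟨Equiv.ofBijective f (Finite.injective_iff_bijective.1 hf), fun a b => ?_⟩
  simp only [Inverted, Equiv.ofBijective_apply, f, Fin.mk_lt_mk]
  constructor
  · rintro ⟨hab, h⟩
    by_contra hT
    exact lt_asymm h (hrank a b (.inl ⟨hab, hT⟩))
  · exact fun h => ⟨hlt a b h, hrank b a (.inr h)⟩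

/-- A step of the chain from `a` to `c` passes over `b`, or stops there. -/
theorem transGen_or_of_between {U : Fin n → Fin n → Prop}
    (hU : ∀ a b c, a < b → b < c → U a c → U a b ∨ U b c) {a b c : Fin n}
    (h : Relation.TransGen U a c) (hab : a < b) (hbc : b < c) :
    Relation.TransGen U a b ∨ Relation.TransGen U b c := by
  induction h with
  | single h => exact (hU _ _ _ hab hbc h).imp .single .single
  | @tail d e had hde ih =>
    rcases lt_trichotomy b d with h | rfl | h
    · exact (ih h).imp_right fun h' => h'.tail hde
    · exact .inl had
    · exact (hU _ _ _ h hbc hde).imp had.tail .single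

theorem transGen_lt {U : Fin n → Fin n → Prop} (hU : ∀ a b, U a b → a < b) {a b : Fin n}
    (h : Relation.TransGen U a b) : a < b := by
  induction h with
  | single h => exact hU _ _ h
  | tail _ h ih => exact ih.trans (hU _ _ h)

theorem exists_join (σ ρ : Equiv.Perm (Fin n)) : ∃ τ : Equiv.Perm (Fin n), ∀ a b,
    Inverted τ a b ↔ Relation.TransGen (fun a b => Inverted σ a b ∨ Inverted ρ a b) a b := by
  refine exists_inverted_iff _ (fun a b h => transGen_lt (fun _ _ h => h.elim And.left And.left) h)
    (fun _ _ _ => .trans) fun a b c hab hbc h => transGen_or_of_between ?_ h hab hbc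
  rintro a b c hab hbc (h | h)
  · exact (h.or_of_between hab hbc).imp .inl .inl
  · exact (h.or_of_between hab hbc).imp .inr .inr

theorem exists_meet (σ ρ : Equiv.Perm (Fin n)) : ∃ τ : Equiv.Perm (Fin n), ∀ a b,
    Inverted τ a b ↔ a < b ∧ ¬ Relation.TransGen
      (fun a b => (a < b ∧ ¬ Inverted σ a b) ∨ (a < b ∧ ¬ Inverted ρ a b)) a b := by
  refine exists_inverted_iff _ (fun a b h => h.1) ?_ ?_
  · rintro a b c ⟨hab, h₁⟩ ⟨hbc, h₂⟩
    refine ⟨hab.trans hbc, fun h => (transGen_or_of_between ?_ h hab hbc).elim h₁ h₂⟩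
    rintro a b c hab hbc (h | h)
    · by_contra hn
      simp only [not_or] at hn
      exact h.2 (.trans (by_contra fun h' => hn.1.1 ⟨hab, h'⟩) (by_contra fun h' =>
        hn.2.1 ⟨hbc, h'⟩))
    · by_contra hn
      simp only [not_or] at hn
      exact h.2 (.trans (by_contra fun h' => hn.1.2 ⟨hab, h'⟩) (by_contra fun h' =>
        hn.2.2 ⟨hbc, h'⟩))
  · rintro a b c hab hbc ⟨-, h⟩
    by_contra hn
    rw [not_or] at hn
    exact h (.trans (by_contra fun h' => hn.1 ⟨hab, h'⟩) (by_contra fun h' => hn.2 ⟨hbc, h'⟩))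

/-- The join: its inversion relation is the transitive closure of the union of the two given ones. -/
noncomputable def weakSup (σ ρ : Equiv.Perm (Fin n)) : Equiv.Perm (Fin n) :=
  (exists_join σ ρ).choose

theorem inverted_weakSup {σ ρ : Equiv.Perm (Fin n)} {a b : Fin n} :
    Inverted (weakSup σ ρ) a b ↔
      Relation.TransGen (fun a b => Inverted σ a b ∨ Inverted ρ a b) a b :=
  (exists_join σ ρ).choose_spec a b

/-- The meet: its non-inversions are the transitive closure of the union of the two given relations
of non-inversion. -/
noncomputable def weakInf (σ ρ : Equiv.Perm (Fin n)) : Equiv.Perm (Fin n) :=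
  (exists_meet σ ρ).choose

theorem inverted_weakInf {σ ρ : Equiv.Perm (Fin n)} {a b : Fin n} :
    Inverted (weakInf σ ρ) a b ↔ a < b ∧ ¬ Relation.TransGen
      (fun a b => (a < b ∧ ¬ Inverted σ a b) ∨ (a < b ∧ ¬ Inverted ρ a b)) a b :=
  (exists_meet σ ρ).choose_spec a b

/-- The weak Bruhat order, as a lattice, on a type that is identified with `S_n`. -/
@[reducible]
noncomputable def weakLattice {X : Type*} (e : X ≃ Equiv.Perm (Fin n)) : Lattice X where
  le x y := ∀ a b, Inverted (e x) a b → Inverted (e y) a b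
  le_refl _ _ _ := id
  le_trans _ _ _ h h' a b := h' a b ∘ h a b
  le_antisymm _ _ h h' := e.injective (eq_of_inverted_iff fun a b => ⟨h a b, h' a b⟩)
  sup x y := e.symm (weakSup (e x) (e y))
  inf x y := e.symm (weakInf (e x) (e y))
  le_sup_left x y a b h := by
    rw [e.apply_symm_apply, inverted_weakSup]
    exact .single (.inl h)
  le_sup_right x y a b h := by
    rw [e.apply_symm_apply, inverted_weakSup]
    exact .single (.inr h)
  sup_le x y z hx hy a b h := by
    rw [e.apply_symm_apply, inverted_weakSup] at h
    induction h with
    | single h => exact h.elim (hx _ _) (hy _ _)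
    | tail _ h ih => exact ih.trans (h.elim (hx _ _) (hy _ _))
  inf_le_left x y a b h := by
    rw [e.apply_symm_apply, inverted_weakInf] at h
    by_contra hn
    exact h.2 (.single (.inl ⟨h.1, hn⟩))
  inf_le_right x y a b h := by
    rw [e.apply_symm_apply, inverted_weakInf] at h
    by_contra hn
    exact h.2 (.single (.inr ⟨h.1, hn⟩))
  le_inf x y z hy hz a b h := by
    rw [e.apply_symm_apply, inverted_weakInf]
    refine ⟨h.1, fun ht => ?_⟩
    -- All non-inversions of `y` and of `z` are non-inversions of `x`.
    have hx : ∀ c d : Fin n, (c < d ∧ ¬ Inverted (e y) c d) ∨ (c < d ∧ ¬ Inverted (e z) c d) →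
        e x c < e x d := by
      rintro c d (⟨hcd, hn⟩ | ⟨hcd, hn⟩)
      · exact (not_inverted_iff hcd).1 (mt (hy c d) hn)
      · exact (not_inverted_iff hcd).1 (mt (hz c d) hn)
    have hlt : e x a < e x b := by
      clear h
      induction ht with
      | single h => exact hx _ _ h
      | tail _ h ih => exact ih.trans (hx _ _ h)
    exact lt_asymm hlt h.2

end WeakOrder

/-! ### The sylvester congruence -/

section Congruence

variable {n : ℕ} {K : Fin n → Fin n → Prop}

/-- Among the pairs of positions in `K`, those pairs `a ≤ b` for which `σ b` is larger than all
values at `a, …, b - 1`. -/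
def LeftSpan (K : Fin n → Fin n → Prop) (σ : Equiv.Perm (Fin n)) (a b : Fin n) : Prop :=
  a ≤ b ∧ K a b ∧ ∀ c, a ≤ c → c < b → ¬ Inverted σ c b

/-- Among the pairs of positions in `K`, those pairs `a ≤ b` for which `σ a` is larger than all
values at `a + 1, …, b`. -/
def RightSpan (K : Fin n → Fin n → Prop) (σ : Equiv.Perm (Fin n)) (a b : Fin n) : Prop :=
  a ≤ b ∧ K a b ∧ ∀ c, a < c → c ≤ b → Inverted σ a c

/-- The last step of a chain of inversions that ends at `b` is an inversion of one of the two
permutations. -/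
theorem leftSpan_weakSup {σ ρ : Equiv.Perm (Fin n)} {a b : Fin n} :
    LeftSpan K (weakSup σ ρ) a b ↔ LeftSpan K σ a b ∧ LeftSpan K ρ a b := by
  simp only [LeftSpan, inverted_weakSup]
  constructor
  · rintro ⟨hab, hK, h⟩
    exact ⟨⟨hab, hK, fun c h₁ h₂ h' => h c h₁ h₂ (.single (.inl h'))⟩,
      ⟨hab, hK, fun c h₁ h₂ h' => h c h₁ h₂ (.single (.inr h'))⟩⟩
  · rintro ⟨⟨hab, hK, h⟩, -, -, h'⟩
    refine ⟨hab, hK, fun c h₁ _ ht => ?_⟩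
    have hlt : ∀ c d, Inverted σ c d ∨ Inverted ρ c d → c < d :=
      fun _ _ h => h.elim And.left And.left
    obtain ⟨d, hcd, hdb⟩ := Relation.TransGen.tail'_iff.1 ht
    have had : a ≤ d := by
      rcases (Relation.reflTransGen_iff_eq_or_transGen.1 hcd) with rfl | hcd
      · exact h₁
      · exact h₁.trans (transGen_lt hlt hcd).le
    exact hdb.elim (h d had (hlt _ _ hdb)) (h' d had (hlt _ _ hdb))

/-- The first step of a chain of non-inversions that starts at `a` is a non-inversion of one of the
two permutations. -/
theorem rightSpan_weakInf {σ ρ : Equiv.Perm (Fin n)} {a b : Fin n} :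
    RightSpan K (weakInf σ ρ) a b ↔ RightSpan K σ a b ∧ RightSpan K ρ a b := by
  simp only [RightSpan, inverted_weakInf]
  constructor
  · rintro ⟨hab, hK, h⟩
    exact ⟨⟨hab, hK, fun c h₁ h₂ => by_contra fun h' =>
        (h c h₁ h₂).2 (.single (.inl ⟨h₁, h'⟩))⟩,
      ⟨hab, hK, fun c h₁ h₂ => by_contra fun h' => (h c h₁ h₂).2 (.single (.inr ⟨h₁, h'⟩))⟩⟩
  · rintro ⟨⟨hab, hK, h⟩, -, -, h'⟩
    refine ⟨hab, hK, fun c h₁ h₂ => ⟨h₁, fun ht => ?_⟩⟩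
    have hlt : ∀ c d : Fin n, (c < d ∧ ¬ Inverted σ c d) ∨ (c < d ∧ ¬ Inverted ρ c d) → c < d :=
      fun _ _ h => h.elim And.left And.left
    obtain ⟨d, had, hdc⟩ := Relation.TransGen.head'_iff.1 ht
    have hdb : d ≤ b := by
      rcases (Relation.reflTransGen_iff_eq_or_transGen.1 hdc) with rfl | hdc
      · exact h₂
      · exact (transGen_lt hlt hdc).le.trans h₂
    rcases had with ⟨h₃, h₄⟩ | ⟨h₃, h₄⟩
    · exact h₄ (h d h₃ hdb)
    · exact h₄ (h' d h₃ hdb)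

/-- If some value at `a + 1, …, b` is larger than `σ a`, then the first such value is also
larger than all values between it and `σ a`. -/
theorem rightSpan_iff_leftSpan (hK : ∀ {a b a' b'}, K a b → a ≤ a' → b' ≤ b → K a' b')
    {σ : Equiv.Perm (Fin n)} {a b : Fin n} :
    RightSpan K σ a b ↔ a ≤ b ∧ K a b ∧ ∀ c, a < c → c ≤ b → ¬ LeftSpan K σ a c := by
  refine and_congr_right fun _ => and_congr_right fun hab => ⟨fun h c h₁ h₂ h' => ?_, fun h => ?_⟩
  · exact h'.2.2 a le_rfl h₁ (h c h₁ h₂)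
  · intro c
    induction c using WellFoundedLT.induction with
    | _ c ih =>
      intro h₁ h₂
      by_contra hn
      refine h c h₁ h₂ ⟨h₁.le, hK hab le_rfl h₂, fun d h₃ h₄ h₅ => ?_⟩
      rcases h₃.eq_or_lt with rfl | h₃
      · exact hn h₅
      · exact hn ((ih d h₄ h₃ (h₄.le.trans h₂)).trans h₅)

/-- If some value at `a, …, b - 1` is larger than `σ b`, then the last such value is also larger
than all values between it and `σ b`. -/
theorem leftSpan_iff_rightSpan (hK : ∀ {a b a' b'}, K a b → a ≤ a' → b' ≤ b → K a' b')
    {σ : Equiv.Perm (Fin n)} {a b : Fin n} :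
    LeftSpan K σ a b ↔ a ≤ b ∧ K a b ∧ ∀ c, a ≤ c → c < b → ¬ RightSpan K σ c b := by
  refine and_congr_right fun _ => and_congr_right fun hab => ⟨fun h c h₁ h₂ h' => ?_, fun h => ?_⟩
  · exact h c h₁ h₂ (h'.2.2 b h₂ le_rfl)
  · intro c
    induction c using WellFoundedGT.induction with
    | _ c ih =>
      intro h₁ h₂ hn
      refine h c h₁ h₂ ⟨h₂.le, hK hab h₁ le_rfl, fun d h₃ h₄ => ?_⟩
      rcases h₄.eq_or_lt with rfl | h₄
      · exact hn
      · exact (hn.or_of_between h₃ h₄).resolve_right (ih d h₃ (h₁.trans h₃.le) h₄)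

theorem leftSpan_congr_iff_rightSpan_congr
    (hK : ∀ {a b a' b'}, K a b → a ≤ a' → b' ≤ b → K a' b') {σ ρ : Equiv.Perm (Fin n)} :
    (∀ a b, LeftSpan K σ a b ↔ LeftSpan K ρ a b) ↔
      ∀ a b, RightSpan K σ a b ↔ RightSpan K ρ a b := by
  constructor
  · intro h a b
    simp only [rightSpan_iff_leftSpan hK, h]
  · intro h a b
    simp only [leftSpan_iff_rightSpan hK, h]

/-- Two permutations are congruent if they have the same left spans within `K`. For `K` the total
relation, this is the sylvester congruence. -/
@[reducible]
noncomputable def spanCon {X : Type*} (e : X ≃ Equiv.Perm (Fin n)) (K : Fin n → Fin n → Prop)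
    (hK : ∀ {a b a' b'}, K a b → a ≤ a' → b' ≤ b → K a' b') :
    letI := weakLattice e
    LatticeCon X :=
  letI := weakLattice e
  { r := fun x y => ∀ a b, LeftSpan K (e x) a b ↔ LeftSpan K (e y) a b
    iseqv := ⟨fun _ _ _ => Iff.rfl, fun h a b => (h a b).symm, fun h h' a b =>
      (h a b).trans (h' a b)⟩
    sup := fun {w x y z} h h' a b => by
      change LeftSpan K (e (e.symm (weakSup (e w) (e y)))) a b ↔
        LeftSpan K (e (e.symm (weakSup (e x) (e z)))) a b
      rw [e.apply_symm_apply, e.apply_symm_apply, leftSpan_weakSup, leftSpan_weakSup, h, h']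
    inf := fun {w x y z} h h' => by
      rw [leftSpan_congr_iff_rightSpan_congr hK] at h h' ⊢
      intro a b
      change RightSpan K (e (e.symm (weakInf (e w) (e y)))) a b ↔
        RightSpan K (e (e.symm (weakInf (e x) (e z)))) a b
      rw [e.apply_symm_apply, e.apply_symm_apply, rightSpan_weakInf, rightSpan_weakInf, h, h'] }

/-- The class of an element. -/
def LatticeQuotient.mk {X : Type*} [Lattice X] (c : LatticeCon X) (x : X) : LatticeQuotient c :=
  Quotient.mk c.toSetoid x

theorem LatticeQuotient.mk_surjective {X : Type*} [Lattice X] (c : LatticeCon X) :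
    Function.Surjective (LatticeQuotient.mk c) :=
  Quotient.mk_surjective

theorem LatticeQuotient.mk_le_mk_iff {X : Type*} [Lattice X] (c : LatticeCon X) {x y : X} :
    LatticeQuotient.mk c x ≤ LatticeQuotient.mk c y ↔ c.r (x ⊔ y) y := by
  rw [← sup_eq_right]
  exact Quotient.eq (r := c.toSetoid)

/-- Since the left spans of a join are the common left spans, the quotient order is the reverse
inclusion of left spans. -/
theorem spanCon_mk_le_mk_iff {X : Type*} (e : X ≃ Equiv.Perm (Fin n))
    (hK : ∀ {a b a' b'}, K a b → a ≤ a' → b' ≤ b → K a' b') {x y : X} :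
    letI := weakLattice e
    LatticeQuotient.mk (spanCon e K hK) x ≤ LatticeQuotient.mk (spanCon e K hK) y ↔
      ∀ a b, LeftSpan K (e y) a b → LeftSpan K (e x) a b := by
  let := weakLattice e
  rw [LatticeQuotient.mk_le_mk_iff]
  change (∀ a b, LeftSpan K (e (e.symm (weakSup (e x) (e y)))) a b ↔ LeftSpan K (e y) a b) ↔ _
  simp only [e.apply_symm_apply, leftSpan_weakSup, and_iff_right_iff_imp]

end Congruence

/-! ### Permutations with a block pattern -/

/-- Without the restriction to a relation `K`, the left spans of a permutation are the left
dominations among its values. -/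
theorem leftDominates_permEntry_iff {n : ℕ} {σ : Equiv.Perm (Fin n)} {a b : Fin n} :
    LeftDominates (permEntry σ) a b ↔ LeftSpan (fun _ _ => True) σ a b := by
  have hσ : ∀ c : Fin n, permEntry σ c = (σ c : WithTop (Fin n)) := fun c => by simp [permEntry]
  simp only [LeftDominates, LeftSpan, hσ, true_and, ne_eq, WithTop.coe_ne_top, not_false_eq_true]
  refine and_congr Iff.rfl ⟨fun h c h₁ h₂ => ?_, fun h z h₁ h₂ => ?_⟩
  · rw [not_inverted_iff h₂]
    simpa [hσ] using h c h₁ h₂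
  · have := (not_inverted_iff (a := ⟨z, h₂.trans b.2⟩) (b := b) h₂).1 (h ⟨z, h₂.trans b.2⟩ h₁ h₂)
    simpa [permEntry, h₂.trans b.2] using this

theorem permEquiv_iff_leftSpan {n : ℕ} {σ ρ : Equiv.Perm (Fin n)} :
    PermEquiv σ ρ ↔
      ∀ a b, LeftSpan (fun _ _ => True) σ a b ↔ LeftSpan (fun _ _ => True) ρ a b := by
  rw [permEquiv_iff_leftDominates]
  constructor
  · intro h a b
    rw [← leftDominates_permEntry_iff, h, leftDominates_permEntry_iff]
  · intro h x y
    have hlt : ∀ {τ : Equiv.Perm (Fin n)}, LeftDominates (permEntry τ) x y → x < n ∧ y < n := by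
      intro τ h
      have hy : y < n := by
        by_contra hy
        exact h.2.1 (by simp [permEntry, hy])
      exact ⟨h.1.trans_lt hy, hy⟩
    by_cases hxy : x < n ∧ y < n
    · have := h ⟨x, hxy.1⟩ ⟨y, hxy.2⟩
      rwa [← leftDominates_permEntry_iff, ← leftDominates_permEntry_iff] at this
    · exact iff_of_false (fun h => hxy (hlt h)) (fun h => hxy (hlt h))

namespace BlockPattern

variable {k : ℕ} (P : BlockPattern k)

/-- The `a`-th position of a block pattern, from left to right. -/
def position : Fin P.n ↪o ℕ+ :=
  P.positions.orderEmbOfFin rfl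

theorem position_mem (a : Fin P.n) : P.position a ∈ P.positions :=
  P.positions.orderEmbOfFin_mem rfl a

theorem exists_position_eq {p : ℕ+} (hp : p ∈ P.positions) : ∃ a, P.position a = p := by
  have : p ∈ Set.range (P.positions.orderEmbOfFin rfl) := by
    rwa [Finset.range_orderEmbOfFin]
  exact this

theorem mem_positions_iff {p : ℕ+} :
    p ∈ P.positions ↔ ∃ i, P.start i ≤ p ∧ p < P.start i + P.size i := by
  simp [positions]

/-- There is no `*` between the `a`-th and the `b`-th concrete symbol. -/
def Contiguous (a b : Fin P.n) : Prop :=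
  ∀ p, P.position a ≤ p → p ≤ P.position b → p ∈ P.positions

theorem Contiguous.mono {a b a' b' : Fin P.n} (h : P.Contiguous a b) (ha : a ≤ a')
    (hb : b' ≤ b) : P.Contiguous a' b' := fun p h₁ h₂ =>
  h p ((P.position.monotone ha).trans h₁) (h₂.trans (P.position.monotone hb))

theorem exists_blockIndex (i : Fin k) (a : Fin (P.size i)) :
    ∃ b, (P.position b : ℕ) = P.start i + a := by
  obtain ⟨p, hp⟩ : ∃ p : ℕ+, (p : ℕ) = P.start i + a :=
    ⟨⟨_, Nat.add_pos_left (P.start i).pos _⟩, rfl⟩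
  obtain ⟨b, hb⟩ := P.exists_position_eq (p := p) (P.mem_positions_iff.2 ⟨i,
    by rw [← PNat.coe_le_coe]; omega, by rw [← PNat.coe_lt_coe, PNat.add_coe]; omega⟩)
  exact ⟨b, by rw [hb, hp]⟩

/-- The index, among all concrete symbols, of the `a`-th symbol of the `i`-th block. -/
noncomputable def blockIndex (i : Fin k) (a : Fin (P.size i)) : Fin P.n :=
  (P.exists_blockIndex i a).choose

theorem position_blockIndex (i : Fin k) (a : Fin (P.size i)) :
    (P.position (P.blockIndex i a) : ℕ) = P.start i + a :=
  (P.exists_blockIndex i a).choose_spec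

theorem lt_iff_position {a b : Fin P.n} : a < b ↔ (P.position a : ℕ) < P.position b := by
  rw [PNat.coe_lt_coe, P.position.lt_iff_lt]

theorem le_iff_position {a b : Fin P.n} : a ≤ b ↔ (P.position a : ℕ) ≤ P.position b := by
  rw [PNat.coe_le_coe, P.position.le_iff_le]

theorem blockIndex_lt_blockIndex {i : Fin k} {a b : Fin (P.size i)} :
    P.blockIndex i a < P.blockIndex i b ↔ a < b := by
  rw [lt_iff_position, position_blockIndex, position_blockIndex, Fin.lt_def]
  omega

theorem blockIndex_le_blockIndex {i : Fin k} {a b : Fin (P.size i)} :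
    P.blockIndex i a ≤ P.blockIndex i b ↔ a ≤ b := by
  rw [← not_lt, blockIndex_lt_blockIndex, not_lt]

theorem start_add_size_lt {i j : Fin k} (h : i < j) :
    (P.start i + P.size i : ℕ) < P.start j := by
  have := P.separated i j h
  rwa [← PNat.coe_lt_coe, PNat.add_coe] at this

/-- Blocks do not touch: a position of a block is not even adjacent to another block. -/
theorem eq_of_mem_block {i j : Fin k} {p : ℕ} (h₁ : P.start i ≤ p) (h₂ : p ≤ P.start i + P.size i)
    (h₃ : P.start j ≤ p) (h₄ : p ≤ P.start j + P.size j) : i = j := by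
  by_contra hne
  rcases lt_or_gt_of_ne hne with h | h <;> have := P.start_add_size_lt h <;> omega

theorem eq_of_blockIndex_eq {i j : Fin k} {a : Fin (P.size i)} {b : Fin (P.size j)}
    (h : P.blockIndex i a = P.blockIndex j b) : i = j := by
  have h' : (P.start i + a : ℕ) = P.start j + b := by
    rw [← position_blockIndex, ← position_blockIndex, h]
  exact P.eq_of_mem_block (p := P.start i + a) (by omega) (by omega) (by omega) (by omega)

theorem blockIndex_injective (i : Fin k) : Function.Injective (P.blockIndex i) := fun _ _ h =>
  le_antisymm (P.blockIndex_le_blockIndex.1 h.le) (P.blockIndex_le_blockIndex.1 h.ge)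

theorem exists_eq_blockIndex_of_position {i : Fin k} {c : Fin P.n}
    (h₁ : (P.start i : ℕ) ≤ P.position c) (h₂ : (P.position c : ℕ) < P.start i + P.size i) :
    ∃ d, c = P.blockIndex i d := by
  refine ⟨⟨P.position c - P.start i, by omega⟩, P.position.injective (PNat.eq ?_)⟩
  rw [position_blockIndex]
  simp only
  omega

theorem exists_eq_blockIndex_of_between {i : Fin k} {a b : Fin (P.size i)} {c : Fin P.n}
    (h₁ : P.blockIndex i a ≤ c) (h₂ : c ≤ P.blockIndex i b) : ∃ d, c = P.blockIndex i d := by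
  rw [le_iff_position, position_blockIndex] at h₁ h₂
  exact P.exists_eq_blockIndex_of_position (by omega) (by omega)

theorem contiguous_blockIndex {i : Fin k} {a b : Fin (P.size i)} :
    P.Contiguous (P.blockIndex i a) (P.blockIndex i b) := by
  intro p h₁ h₂
  rw [← PNat.coe_le_coe, position_blockIndex] at h₁ h₂
  refine P.mem_positions_iff.2 ⟨i, ?_, ?_⟩
  · rw [← PNat.coe_le_coe]
    omega
  · rw [← PNat.coe_lt_coe, PNat.add_coe]
    omega

/-- A run of positions without `*` lies in one block: otherwise it contains the gap just after the
block in which it starts. -/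
theorem Contiguous.exists_block {a b : Fin P.n} (h : P.Contiguous a b) (hab : a ≤ b) :
    ∃ i a' b', a = P.blockIndex i a' ∧ b = P.blockIndex i b' := by
  obtain ⟨i, h₁, h₂⟩ := P.mem_positions_iff.1 (P.position_mem a)
  rw [← PNat.coe_le_coe] at h₁
  rw [← PNat.coe_lt_coe, PNat.add_coe] at h₂
  rw [le_iff_position] at hab
  obtain ⟨a', ha'⟩ := P.exists_eq_blockIndex_of_position h₁ h₂
  have hb : (P.position b : ℕ) < P.start i + P.size i := by
    by_contra hb
    have hmem := h (P.start i + P.size i) (by rw [← PNat.coe_le_coe, PNat.add_coe]; omega)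
      (by rw [← PNat.coe_le_coe, PNat.add_coe]; omega)
    obtain ⟨j, h₃, h₄⟩ := P.mem_positions_iff.1 hmem
    rw [← PNat.coe_le_coe, PNat.add_coe] at h₃
    rw [← PNat.coe_lt_coe, PNat.add_coe, PNat.add_coe] at h₄
    obtain rfl := P.eq_of_mem_block (p := P.start i + P.size i) (by omega) le_rfl h₃ h₄.le
    omega
  obtain ⟨b', hb'⟩ := P.exists_eq_blockIndex_of_position (h₁.trans hab) hb
  exact ⟨i, a', b', ha', hb'⟩

end BlockPattern

namespace PatternPerm

variable {k : ℕ} {P : BlockPattern k}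

theorem apply_position (σ : PatternPerm P) (a : Fin P.n) :
    σ.1.1 (P.position a) = (σ.removeStars a : WithTop (Fin P.n)) :=
  (WithTop.coe_untop _ _).symm

theorem apply_eq_top (σ : PatternPerm P) {p : ℕ+} (hp : p ∉ P.positions) : σ.1.1 p = ⊤ := by
  by_contra h
  exact hp ((σ.2 p).1 h)

theorem removeStars_injective : Function.Injective (removeStars (P := P)) := by
  intro σ ρ h
  refine Subtype.ext (Subtype.ext (funext fun p => ?_))
  by_cases hp : p ∈ P.positions
  · obtain ⟨a, rfl⟩ := P.exists_position_eq hp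
    rw [apply_position, apply_position, h]
  · rw [apply_eq_top σ hp, apply_eq_top ρ hp]

theorem removeStars_surjective : Function.Surjective (removeStars (P := P)) := by
  classical
  intro τ
  let φ : ℕ+ → WithTop (Fin P.n) := fun p =>
    if h : p ∈ P.positions then (τ (P.exists_position_eq h).choose : WithTop (Fin P.n)) else ⊤
  have hφ : ∀ a, φ (P.position a) = (τ a : WithTop (Fin P.n)) := fun a => by
    have := (P.exists_position_eq (P.position_mem a)).choose_spec
    simp only [φ, P.position_mem a, dite_true, P.position.injective this]
  have htop : ∀ p, p ∉ P.positions → φ p = ⊤ := fun p hp => by simp [φ, hp]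
  refine ⟨⟨⟨φ, fun j => ⟨P.position (τ.symm j), by simp [hφ], fun p hp => ?_⟩⟩, fun p => ?_⟩, ?_⟩
  · by_cases hmem : p ∈ P.positions
    · obtain ⟨a, rfl⟩ := P.exists_position_eq hmem
      simp only [hφ, WithTop.coe_inj] at hp
      rw [← hp, τ.symm_apply_apply]
    · simp [htop p hmem] at hp
  · constructor
    · exact fun h => by_contra fun hp => h (htop p hp)
    · intro hp
      obtain ⟨a, rfl⟩ := P.exists_position_eq hp
      simp [hφ]
  · ext1 a
    exact WithTop.coe_injective ((apply_position _ a).symm.trans (hφ a))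

/-- The identification of `S_n'` with `S_n`. -/
noncomputable def equivPerm (P : BlockPattern k) : PatternPerm P ≃ Equiv.Perm (Fin P.n) :=
  Equiv.ofBijective removeStars ⟨removeStars_injective, removeStars_surjective⟩

theorem leftDominates_starEntry_iff {σ : PatternPerm P} {a b : Fin P.n} :
    LeftDominates (starEntry σ.1) (P.position a).natPred (P.position b).natPred ↔
      LeftSpan P.Contiguous σ.removeStars a b := by
  have hσ : ∀ c, starEntry σ.1 (P.position c).natPred = (σ.removeStars c : WithTop (Fin P.n)) :=
    fun c => by rw [starEntry, PNat.succPNat_natPred, apply_position]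
  simp only [LeftDominates, LeftSpan, hσ, PNat.natPred_le_natPred, OrderEmbedding.le_iff_le]
  refine and_congr_right fun _ => ⟨fun h => ⟨fun p h₁ h₂ => ?_, fun c h₁ h₂ => ?_⟩,
    fun h => ⟨WithTop.coe_ne_top, fun z h₁ h₂ => ?_⟩⟩
  · rcases h₂.eq_or_lt with rfl | h₂
    · exact P.position_mem b
    · have := h.2 p.natPred (PNat.natPred_le_natPred.2 h₁) (PNat.natPred_lt_natPred.2 h₂)
      rw [starEntry, PNat.succPNat_natPred] at this
      exact (σ.2 p).1 (ne_top_of_lt this)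
  · have := h.2 (P.position c).natPred (by simpa using h₁) (by simpa using h₂)
    rw [hσ, WithTop.coe_lt_coe] at this
    exact (not_inverted_iff h₂).2 this
  · obtain ⟨p, rfl⟩ : ∃ p : ℕ+, z = p.natPred := ⟨z.succPNat, (Nat.natPred_succPNat z).symm⟩
    rw [PNat.natPred_le_natPred] at h₁
    rw [PNat.natPred_lt_natPred] at h₂
    obtain ⟨c, rfl⟩ := P.exists_position_eq (h.1 p h₁ h₂.le)
    rw [OrderEmbedding.le_iff_le] at h₁
    rw [OrderEmbedding.lt_iff_lt] at h₂
    rw [hσ, WithTop.coe_lt_coe]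
    exact (not_inverted_iff h₂).1 (h.2 c h₁ h₂)

theorem starEquiv_iff_leftSpan {σ ρ : PatternPerm P} :
    StarEquiv σ.1 ρ.1 ↔ ∀ a b,
      LeftSpan P.Contiguous σ.removeStars a b ↔ LeftSpan P.Contiguous ρ.removeStars a b := by
  rw [starEquiv_iff_leftDominates]
  constructor
  · intro h a b
    rw [← leftDominates_starEntry_iff, h, leftDominates_starEntry_iff]
  · intro h x y
    have hpos : ∀ {τ : PatternPerm P}, LeftDominates (starEntry τ.1) x y →
        ∃ a b, x = (P.position a).natPred ∧ y = (P.position b).natPred := by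
      intro τ h
      have hy := (τ.2 _).1 h.2.1
      have hx : x.succPNat ∈ P.positions := by
        rcases h.1.eq_or_lt with rfl | hlt
        · exact hy
        · exact (τ.2 _).1 (ne_top_of_lt (h.2.2 x le_rfl hlt))
      obtain ⟨a, ha⟩ := P.exists_position_eq hx
      obtain ⟨b, hb⟩ := P.exists_position_eq hy
      exact ⟨a, b, by simp [ha], by simp [hb]⟩
    by_cases hxy : ∃ a b, x = (P.position a).natPred ∧ y = (P.position b).natPred
    · obtain ⟨a, b, rfl, rfl⟩ := hxy
      rw [leftDominates_starEntry_iff, leftDominates_starEntry_iff, h]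
    · exact iff_of_false (fun h => hxy (hpos h)) (fun h => hxy (hpos h))

/-- The inversions between positions of the `i`-th block are the inversions of a permutation in
`S_{m_i}`. -/
theorem exists_blockPerm (σ : Equiv.Perm (Fin P.n)) (i : Fin k) :
    ∃ τ : Equiv.Perm (Fin (P.size i)), ∀ a b,
      Inverted τ a b ↔ Inverted σ (P.blockIndex i a) (P.blockIndex i b) :=
  exists_inverted_iff _ (fun _ _ h => P.blockIndex_lt_blockIndex.1 h.1)
    (fun _ _ _ => .trans) fun _ _ _ hab hbc h =>
      h.or_of_between (P.blockIndex_lt_blockIndex.2 hab) (P.blockIndex_lt_blockIndex.2 hbc)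

/-- The pattern of the values of `σ` in the `i`-th block. -/
noncomputable def blockPerm (σ : Equiv.Perm (Fin P.n)) (i : Fin k) :
    Equiv.Perm (Fin (P.size i)) :=
  (exists_blockPerm σ i).choose

theorem inverted_blockPerm {σ : Equiv.Perm (Fin P.n)} {i : Fin k} {a b : Fin (P.size i)} :
    Inverted (blockPerm σ i) a b ↔ Inverted σ (P.blockIndex i a) (P.blockIndex i b) :=
  (exists_blockPerm σ i).choose_spec a b

/-- Arbitrary patterns in the blocks are realized by the permutation whose inversions are the ones
prescribed within the blocks, without inversions between different blocks. -/
theorem exists_blockPerm_eq (τ : ∀ i, Equiv.Perm (Fin (P.size i))) :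
    ∃ σ : Equiv.Perm (Fin P.n), ∀ i, blockPerm σ i = τ i := by
  obtain ⟨σ, hσ⟩ := exists_inverted_iff
    (fun a b => ∃ i a' b', a = P.blockIndex i a' ∧ b = P.blockIndex i b' ∧ Inverted (τ i) a' b')
    (by
      rintro a b ⟨i, a', b', rfl, rfl, h⟩
      exact P.blockIndex_lt_blockIndex.2 h.1)
    (by
      rintro a b c ⟨i, a', b', rfl, rfl, h⟩ ⟨j, b'', c', h', rfl, h''⟩
      obtain rfl := P.eq_of_blockIndex_eq h'
      obtain rfl := P.blockIndex_injective i h'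
      exact ⟨i, a', c', rfl, rfl, h.trans h''⟩)
    (by
      rintro a b c hab hbc ⟨i, a', c', rfl, rfl, h⟩
      obtain ⟨b', rfl⟩ := P.exists_eq_blockIndex_of_between hab.le hbc.le
      rw [P.blockIndex_lt_blockIndex] at hab hbc
      exact (h.or_of_between hab hbc).imp (fun h => ⟨i, a', b', rfl, rfl, h⟩)
        fun h => ⟨i, b', c', rfl, rfl, h⟩)
  refine ⟨σ, fun i => eq_of_inverted_iff fun a b => ?_⟩
  rw [inverted_blockPerm, hσ]
  constructor
  · rintro ⟨j, a', b', ha, hb, h⟩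
    obtain rfl := P.eq_of_blockIndex_eq ha
    rwa [P.blockIndex_injective _ ha, P.blockIndex_injective _ hb]
  · exact fun h => ⟨i, a, b, rfl, rfl, h⟩

theorem leftSpan_blockPerm {σ : Equiv.Perm (Fin P.n)} {i : Fin k} {a b : Fin (P.size i)} :
    LeftSpan (fun _ _ => True) (blockPerm σ i) a b ↔
      LeftSpan P.Contiguous σ (P.blockIndex i a) (P.blockIndex i b) := by
  simp only [LeftSpan, inverted_blockPerm, P.blockIndex_le_blockIndex, true_and,
    P.contiguous_blockIndex]
  refine and_congr_right fun _ => ⟨fun h c h₁ h₂ => ?_, fun h c h₁ h₂ => ?_⟩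
  · obtain ⟨d, rfl⟩ := P.exists_eq_blockIndex_of_between h₁ h₂.le
    exact h d (P.blockIndex_le_blockIndex.1 h₁) (P.blockIndex_lt_blockIndex.1 h₂)
  · exact h _ (P.blockIndex_le_blockIndex.2 h₁) (P.blockIndex_lt_blockIndex.2 h₂)

theorem leftSpan_imp_iff_blockPerm {σ ρ : Equiv.Perm (Fin P.n)} :
    (∀ a b, LeftSpan P.Contiguous ρ a b → LeftSpan P.Contiguous σ a b) ↔
      ∀ i a b, LeftSpan (fun _ _ => True) (blockPerm ρ i) a b →
        LeftSpan (fun _ _ => True) (blockPerm σ i) a b := by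
  simp only [leftSpan_blockPerm]
  constructor
  · exact fun h i a b => h _ _
  · intro h a b hab
    obtain ⟨i, a', b', rfl, rfl⟩ := BlockPattern.Contiguous.exists_block P hab.2.1 hab.1
    exact h i a' b' hab

end PatternPerm

/-- Two surjective maps that induce the same preorder have isomorphic images. -/
theorem nonempty_orderIso_of_surjective {X A B : Type*} [PartialOrder A] [PartialOrder B]
    {f : X → A} {g : X → B} (hf : Function.Surjective f) (hg : Function.Surjective g)
    (h : ∀ x y, f x ≤ f y ↔ g x ≤ g y) : Nonempty (A ≃o B) := by
  let e : A ↪o B := OrderEmbedding.ofMapLEIff (fun a => g (Function.surjInv hf a)) fun a b => by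
    rw [← h, Function.surjInv_eq hf, Function.surjInv_eq hf]
  refine ⟨RelIso.ofSurjective e fun b => ?_⟩
  obtain ⟨x, rfl⟩ := hg b
  have hx : f (Function.surjInv hf (f x)) = f x := Function.surjInv_eq hf _
  exact ⟨f x, le_antisymm ((h _ _).1 hx.le) ((h _ _).1 hx.ge)⟩

end Tamari

open Tamari in
theorem mainTheorem2 {k : ℕ} (P : Tamari.BlockPattern k) :
    -- the weak Bruhat orders on `S_n'` and on `S_{m_1}, …, S_{m_k}` are lattice orders
    ∃ (_ : Lattice (Tamari.PatternPerm P))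
      (_ : ∀ i : Fin k, Lattice (Equiv.Perm (Fin (P.size i)))),
      (∀ σ ρ : Tamari.PatternPerm P, σ ≤ ρ ↔ σ.WeakLE ρ) ∧
      (∀ (i : Fin k) (σ ρ : Equiv.Perm (Fin (P.size i))), σ ≤ ρ ↔ Tamari.WeakLE σ ρ) ∧
      -- the relation `∼` is a lattice congruence on each of them
      ∃ (c : LatticeCon (Tamari.PatternPerm P))
        (d : ∀ i : Fin k, LatticeCon (Equiv.Perm (Fin (P.size i)))),
        (∀ σ ρ : Tamari.PatternPerm P, c.r σ ρ ↔ Tamari.StarEquiv σ.1 ρ.1) ∧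
        (∀ (i : Fin k) (σ ρ : Equiv.Perm (Fin (P.size i))),
          (d i).r σ ρ ↔ Tamari.PermEquiv σ ρ) ∧
        -- and the quotient lattices are isomorphic
        Nonempty (Tamari.LatticeQuotient c ≃o ∀ i : Fin k, Tamari.LatticeQuotient (d i)) := by
  let := weakLattice (PatternPerm.equivPerm P)
  let := fun i : Fin k => weakLattice (Equiv.refl (Equiv.Perm (Fin (P.size i))))
  let c := spanCon (PatternPerm.equivPerm P) P.Contiguous (BlockPattern.Contiguous.mono P)
  let d := fun i : Fin k =>
    spanCon (Equiv.refl (Equiv.Perm (Fin (P.size i)))) (fun _ _ => True) fun _ _ _ => trivial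
  refine ⟨inferInstance, inferInstance, fun σ ρ => weakLE_iff.symm, fun i σ ρ => weakLE_iff.symm,
    c, d, fun σ ρ => PatternPerm.starEquiv_iff_leftSpan.symm,
    fun i σ ρ => permEquiv_iff_leftSpan.symm, ?_⟩
  refine nonempty_orderIso_of_surjective (f := LatticeQuotient.mk c)
    (g := fun σ i => LatticeQuotient.mk (d i) (PatternPerm.blockPerm σ.removeStars i))
    (LatticeQuotient.mk_surjective c) ?_ fun σ ρ => ?_
  · intro q
    choose τ hτ using fun i => LatticeQuotient.mk_surjective (d i) (q i)
    obtain ⟨σ, hσ⟩ := PatternPerm.exists_blockPerm_eq τ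
    obtain ⟨σ, rfl⟩ := PatternPerm.removeStars_surjective σ
    exact ⟨σ, funext fun i => by simp only [hσ, hτ]⟩
  · refine (spanCon_mk_le_mk_iff (PatternPerm.equivPerm P) (BlockPattern.Contiguous.mono P)).trans
      (PatternPerm.leftSpan_imp_iff_blockPerm.trans (forall_congr' fun i => ?_))
    exact (spanCon_mk_le_mk_iff (Equiv.refl (Equiv.Perm (Fin (P.size i)))) _).symm
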